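/- **Bounds on the growth-within-mode constants.** For an integer $k\ge 0$ let $\eta_k$ be the critical three-colour mean-field Potts distribution on $\{1,2,3\}^k$, $$\eta_k(\sigma)=\frac{\exp\big(k\,\tilde\beta_c\,(s_1(\sigma)^2+s_2(\sigma)^2+s_3(\sigma)^2)\big)}{Z_k},\qquad \tilde\beta_c=2\log 2,$$ where $s_i(\sigma)$ is the proportion of coordinates of $\sigma$ equal to $i$ and $Z_k$ is the normalising constant ($\eta_0$ is the point mass on the empty configuration). For $M\ge 1$ let $\Omega=\{1,2,3\}^M$ and let $\mu_0,\dots,\mu_M$ be the interpolation-to-independence sequence: under $\mu_k$ the first $k$ coordinates of $x\in\Omega$ have law $\eta_k$ and the remaining $M-k$ coordinates are i.i.d. uniform on $\{1,2,3\}$, independently of the first $k$. Fix a threshold $J\ge 1$ (for instance $J=10^7$, or $J=1$). For $0\le k\le J$ put $m(k)=1$ and $F_k^{(1)}=\Omega$; for $J<k\le M$ put $m(k)=4$ and $$F_k^{(i)}=\Big\{x\in\Omega:\ \frac1k\sum_{l=1}^k \mathbf 1[x_l=i]>\frac12\Big\}\ (i=1,2,3),\qquad F_k^{(4)}=\Omega\setminus\big(F_k^{(1)}\cup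 F_k^{(2)}\cup F_k^{(3)}\big).$$ For $0\le k\le M-1$ define the growth-within-mode constant $$B_{k,k+1}=\max_{1\le r\le m(k)}\frac{\mu_{k+1}(F_k^{(r)})}{\mu_k(F_k^{(r)})}.$$ Then $B_{0,1}=1$ for $M\ge 1$ and $B_{1,2}=1$ for $M\ge 2$, and there is an absolute constant $C>0$ (depending on none of $J$, $M$, $j$) such that for all $2\le j\le M-1$, $$B_{j,j+1}\le 1+C\,\frac{\log(j)^{3/2}}{j^{3/2}}.$$ -/

import Mathlib

open scoped BigOperators

noncomputable section

namespace MeanFieldPotts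

/-- A configuration of `k` spins with the three colours `0, 1, 2`. -/
abbrev Config (k : ℕ) : Type := Fin k → Fin 3

/-- The number of spins of colour `i` in the configuration `σ`. -/
def colourCount {k : ℕ} (σ : Config k) (i : Fin 3) : ℕ :=
  (Finset.univ.filter fun l : Fin k => σ l = i).card

/-- The ratio of spins of colour `i` in the configuration `σ`
(with the convention that it is `0` for the empty configuration). -/
def colourRatio {k : ℕ} (σ : Config k) (i : Fin 3) : ℝ :=
  (colourCount σ i : ℝ) / (k : ℝ)

/-- The unnormalised mean-field Potts weight `exp (k β (s₁² + s₂² + s₃²))`. -/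
def weight (β : ℝ) {k : ℕ} (σ : Config k) : ℝ :=
  Real.exp ((k : ℝ) * β * ∑ i : Fin 3, colourRatio σ i ^ 2)

/-- The normalising constant of the model with `k` spins. -/
def partitionFunction (β : ℝ) (k : ℕ) : ℝ :=
  ∑ σ : Config k, weight β σ

/-- The probability of `σ` under the three-colour mean-field Potts model with `k` spins. -/
def potts (β : ℝ) {k : ℕ} (σ : Config k) : ℝ :=
  weight β σ / partitionFunction β k

/-- The critical inverse temperature `2 log 2`. -/
def criticalBeta : ℝ := 2 * Real.log 2

/-- The first `k` spins of a configuration of `M` spins. -/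
def initialSpins {k M : ℕ} (h : k ≤ M) (x : Config M) : Config k :=
  fun l => x (Fin.castLE h l)

/-- The `k`-th distribution of the interpolation-to-independence sequence on `Config M`, as a
probability mass function: the first `k` spins follow the critical Potts model with `k` spins, and
each of the other `M - k` spins is uniform on the three colours, all independent. -/
def interpMass {k M : ℕ} (h : k ≤ M) (x : Config M) : ℝ :=
  potts criticalBeta (initialSpins h x) * (1 / 3 : ℝ) ^ (M - k)

open Classical in
/-- The probability of the event `S` under the `k`-th interpolating distribution. -/
def interpProb {k M : ℕ} (h : k ≤ M) (S : Set (Config M)) : ℝ :=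
  ∑ x ∈ Finset.univ.filter (fun x : Config M => x ∈ S), interpMass h x

/-- The number of modes at index `k`: one up to the threshold `J`, four beyond it. -/
def numModes (J k : ℕ) : ℕ := if k ≤ J then 1 else 4

/-- The configurations whose first `k` spins have colour `i` as a strict majority. -/
def majoritySet {k M : ℕ} (h : k ≤ M) (i : Fin 3) : Set (Config M) :=
  {x | 1 / 2 < colourRatio (initialSpins h x) i}

/-- The modes at index `k`, numbered from `0`. Up to the threshold `J` the only mode is the whole
space; beyond it, modes `0, 1, 2` are the strict-majority sets of the three colours, and mode `3`
is what remains. -/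
def mode (J : ℕ) {k M : ℕ} (h : k ≤ M) (r : Fin (numModes J k)) : Set (Config M) :=
  if k ≤ J then Set.univ
  else if hr : (r : ℕ) < 3 then majoritySet h ⟨r, hr⟩
  else (⋃ i : Fin 3, majoritySet h i)ᶜ

/-- The growth-within-mode constant `B_{k,k+1}` for configurations of `M` spins: the maximum over
the finitely many modes at index `k` of the ratio of their probabilities under the `(k+1)`-st and
the `k`-th interpolating distributions. -/
def growthConst (J : ℕ) {k M : ℕ} (h : k + 1 ≤ M) : ℝ :=
  ⨆ r : Fin (numModes J k),
    interpProb h (mode J (Nat.le_of_succ_le h) r) /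
      interpProb (Nat.le_of_succ_le h) (mode J (Nat.le_of_succ_le h) r)

end MeanFieldPotts

end

/-!
Fix a solution `m` of the mean-field equation, with value `P` of the free energy. Adding a spin to a
configuration of profile `s` and summing over its colour multiplies the weight by `exp P` times the
`stepFactor`. Swapping a spin with an additional spin of law `m` is an involution, so over an event
that such swaps nearly preserve, the weighted average of the `exchangeFactor` is nearly `1`. To
second order in `s - m`, where `k⁻¹` counts as a second-order quantity, `exchangeFactor + 1` and
`2 * stepFactor` agree. Hence the `stepFactor` averages to `1 + O(δ³)` over an event whose profiles
are at distance at most `δ` from `m`.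

At the critical temperature the free energy attains its maximum at four profiles, one in each mode,
all with the same `P`. So every mode, and hence the normalising constant, grows by the same factor
`exp P` up to `1 + O(δ³)`. The free energy falls quadratically away from its maximisers, so the
profiles at distance more than `δ` from all of them are negligible for a suitable
`δ² = c * log k / k`, which gives the exponent `3 / 2`.
-/

noncomputable section

open Real Finset

namespace MeanFieldPotts

/-! ## Entropy -/

section Entropy

lemma le_add_mul_sub_of_concaveOn {S : Set ℝ} {f : ℝ → ℝ} {f' x y : ℝ} (hf : ConcaveOn ℝ S f)
    (hx : x ∈ S) (hy : y ∈ S) (hf' : HasDerivAt f f' x) : f y ≤ f x + f' * (y - x) := by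
  rcases lt_trichotomy x y with hxy | rfl | hyx
  · have hslope := hf.slope_le_of_hasDerivAt hx hy hxy hf'
    rw [slope_def_field, div_le_iff₀ (sub_pos.2 hxy)] at hslope
    linarith
  · simp
  · have hslope := hf.le_slope_of_hasDerivAt hy hx hyx hf'
    rw [slope_def_field, le_div_iff₀ (sub_pos.2 hyx)] at hslope
    linarith

lemma hasDerivAt_binEntropy_add_sq {y : ℝ} (a x : ℝ) (hy0 : y ≠ 0) (hy1 : y ≠ 1) :
    HasDerivAt (fun y => binEntropy y + a * (y - x) ^ 2)
      (log (1 - y) - log y + 2 * a * (y - x)) y :=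
  ((hasDerivAt_binEntropy hy0 hy1).fun_add
    ((((hasDerivAt_id' y).sub_const x).fun_pow 2).const_mul a)).congr_deriv (by norm_num; ring)

lemma concaveOn_binEntropy_add_sq {a l u : ℝ} (x : ℝ) (hl : 0 ≤ l) (hu : u ≤ 1)
    (ha : ∀ y ∈ Set.Ioo l u, 2 * a * (y * (1 - y)) ≤ 1) :
    ConcaveOn ℝ (Set.Icc l u) fun y => binEntropy y + a * (y - x) ^ 2 := by
  have hderiv2 (y : ℝ) (hy0 : y ≠ 0) (hy1 : 1 - y ≠ 0) :
      HasDerivAt (fun y => log (1 - y) - log y + 2 * a * (y - x))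
        (-1 / (1 - y) - 1 / y + 2 * a) y :=
    ((((hasDerivAt_id' y).const_sub 1).log hy1 |>.fun_sub ((hasDerivAt_id' y).log hy0)).fun_add
      (((hasDerivAt_id' y).sub_const x).const_mul (2 * a))).congr_deriv (by ring)
  refine concaveOn_of_hasDerivWithinAt2_nonpos (convex_Icc l u) (by fun_prop)
    (f' := fun y => log (1 - y) - log y + 2 * a * (y - x))
    (f'' := fun y => -1 / (1 - y) - 1 / y + 2 * a) ?_ ?_ ?_ <;>
    rw [interior_Icc] <;> intro y hy <;> obtain ⟨hy0, hy1⟩ : 0 < y ∧ 0 < 1 - y := by grind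
  · exact (hasDerivAt_binEntropy_add_sq a x hy0.ne' (by linarith)).hasDerivWithinAt
  · exact (hderiv2 y hy0.ne' hy1.ne').hasDerivWithinAt
  · have hquot : -1 / (1 - y) - 1 / y + 2 * a =
        (2 * a * (y * (1 - y)) - 1) / (y * (1 - y)) := by
      field_simp; ring
    rw [hquot]
    exact div_nonpos_of_nonpos_of_nonneg (by linarith [ha y hy]) (by positivity)

lemma binEntropy_le_quadratic {a l u x p : ℝ} (hl : 0 ≤ l) (hu : u ≤ 1)
    (ha : ∀ y ∈ Set.Ioo l u, 2 * a * (y * (1 - y)) ≤ 1) (hx : x ∈ Set.Ioo l u)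
    (hp : p ∈ Set.Icc l u) :
    binEntropy p ≤ binEntropy x + (log (1 - x) - log x) * (p - x) - a * (p - x) ^ 2 := by
  have htangent := le_add_mul_sub_of_concaveOn (concaveOn_binEntropy_add_sq x hl hu ha)
    (Set.Ioo_subset_Icc_self hx) hp
    (hasDerivAt_binEntropy_add_sq a x (by grind) (by grind))
  linear_combination htangent

lemma binEntropy_le_log_two_sub {p : ℝ} (hp : p ∈ Set.Icc (0 : ℝ) 1) :
    binEntropy p ≤ log 2 - 2 * (p - 1 / 2) ^ 2 := by
  have h := binEntropy_le_quadratic (a := 2) (x := 2⁻¹) le_rfl le_rfl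
    (fun y _ => by nlinarith [sq_nonneg (2 * y - 1)]) (by norm_num) hp
  rw [binEntropy_two_inv] at h
  norm_num at h ⊢
  exact h

lemma binEntropy_two_thirds : binEntropy (2 / 3) = log 3 - 2 / 3 * log 2 := by
  have h23 : log (2 / 3) = log 2 - log 3 := log_div (by norm_num) (by norm_num)
  have h13 : log (1 / 3) = -log 3 := by rw [one_div, log_inv]
  rw [binEntropy_eq_negMulLog_add_negMulLog_one_sub, negMulLog, negMulLog,
    show (1 : ℝ) - 2 / 3 = 1 / 3 by norm_num, h23, h13]
  ring

lemma binEntropy_le_near_two_thirds {p : ℝ} (hp : p ∈ Set.Icc (3 / 5 : ℝ) 1) :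
    binEntropy p ≤
      log 3 - 2 / 3 * log 2 - log 2 * (p - 2 / 3) - 25 / 12 * (p - 2 / 3) ^ 2 := by
  have h := binEntropy_le_quadratic (a := 25 / 12) (x := 2 / 3) (by norm_num) le_rfl
    (fun y hy => by nlinarith [hy.1, hy.2]) (by norm_num) hp
  have h13 : log (1 - 2 / 3 : ℝ) - log (2 / 3) = -log 2 := by
    rw [← log_div (by norm_num) (by norm_num), ← log_inv]
    norm_num
  rw [binEntropy_two_thirds, h13] at h
  linarith

lemma log_three_gt : 19 / 12 * log 2 + 1 / 900 < log 3 := by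
  have h := one_sub_inv_le_log_of_pos (x := 3 ^ 12 / 2 ^ 19) (by norm_num)
  rw [log_div (by norm_num) (by norm_num), log_pow, log_pow] at h
  norm_num at h
  linarith

/-- Equivalently, the critical free energy of the profile `(p, (1 - p) / 2, (1 - p) / 2)` lies below
its maximum by at least the double-well term; there is equality at `p = 1 / 3` and `p = 2 / 3`. -/
lemma binEntropy_le_double_well {p : ℝ} (hp : p ∈ Set.Icc (0 : ℝ) 1) :
    binEntropy p ≤ log 3 - 7 / 12 * log 2 - 3 * log 2 * (p - 1 / 2) ^ 2
      - 1 / 300 * (|p - 1 / 2| - 1 / 6) ^ 2 := by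
  wlog hhalf : 1 / 2 ≤ p generalizing p
  · have h := this (p := 1 - p) ⟨by linarith [hp.2], by linarith [hp.1]⟩ (by linarith)
    rwa [binEntropy_one_sub, show 1 - p - 1 / 2 = -(p - 1 / 2) by ring, abs_neg, neg_sq] at h
  rw [abs_of_nonneg (by linarith)]
  have hlog := log_two_gt_d9
  have hlog' := log_two_lt_d9
  rcases le_total (3 / 5) p with hfar | hnear
  · have h := binEntropy_le_near_two_thirds ⟨hfar, hp.2⟩
    nlinarith [sq_nonneg (p - 2 / 3)]
  · have h := binEntropy_le_log_two_sub hp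
    have hlog3 := log_three_gt
    have hsq : (p - 1 / 2) ^ 2 ≤ 1 / 100 := by nlinarith
    nlinarith

lemma negMulLog_add_le {q r : ℝ} (hq : 0 ≤ q) (hr : 0 ≤ r) :
    negMulLog q + negMulLog r ≤
      negMulLog (q + r) + (q + r) * log 2 - (q - r) ^ 2 / (2 * (q + r)) := by
  rcases (add_nonneg hq hr).eq_or_lt with h0 | hpos
  · obtain ⟨rfl, rfl⟩ : q = 0 ∧ r = 0 := ⟨by linarith, by linarith⟩
    simp
  have hne := hpos.ne'
  have hsplit : negMulLog q + negMulLog r =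
      negMulLog (q + r) + (q + r) * binEntropy (q / (q + r)) := by
    have hq' := negMulLog_mul (q + r) (q / (q + r))
    have hr' := negMulLog_mul (q + r) (r / (q + r))
    rw [mul_div_cancel₀ _ hne] at hq' hr'
    rw [hq', hr', binEntropy_eq_negMulLog_add_negMulLog_one_sub,
      show 1 - q / (q + r) = r / (q + r) by field_simp; ring]
    field_simp
    ring
  have hbin := binEntropy_le_log_two_sub (p := q / (q + r))
    ⟨by positivity, (div_le_one hpos).2 (by linarith)⟩
  have hgap : (q + r) * (2 * (q / (q + r) - 1 / 2) ^ 2) = (q - r) ^ 2 / (2 * (q + r)) := by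
    field_simp; ring
  calc negMulLog q + negMulLog r
      ≤ negMulLog (q + r) + (q + r) * (log 2 - 2 * (q / (q + r) - 1 / 2) ^ 2) := by
        rw [hsplit]; gcongr
    _ = _ := by rw [mul_sub, hgap]; ring

end Entropy

/-! ## Free energy and phases -/

section FreeEnergy

variable {ι : Type*} [Fintype ι]

/-- The mean-field free energy of the colour profile `s`: its Shannon entropy plus `β |s|²`. -/
def freeEnergy (β : ℝ) (s : ι → ℝ) : ℝ :=
  ∑ c, negMulLog (s c) + β * (s ⬝ᵥ s)

/-- The maximum of the critical free energy. -/
def criticalPressure : ℝ := log 3 + 2 / 3 * log 2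

/-- A critical point `m` of the free energy on the simplex, in multiplicative form; the constant
`P` is then the value of the free energy at `m`. -/
structure IsMeanFieldSolution (β P : ℝ) (m : ι → ℝ) : Prop where
  mem_stdSimplex : m ∈ stdSimplex ℝ ι
  exp_eq (c : ι) : exp (2 * β * m c - β * (m ⬝ᵥ m)) = exp P * m c

/-- A phase of the critical model: `some i` is the ordered phase dominated by the colour `i`, and
`none` is the disordered phase. -/
abbrev Phase : Type := Option (Fin 3)

/-- The colour profile at which the critical free energy is maximised in the given phase. -/
def center : Phase → Fin 3 → ℝ
  | none, _ => 1 / 3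
  | some i, c => if c = i then 2 / 3 else 1 / 6

/-- The colour profiles attached to a phase: those with a strict majority of the given colour, or
without any strict majority. -/
def basin : Phase → Set (Fin 3 → ℝ)
  | none => {s | ∀ i, s i ≤ 1 / 2}
  | some i => {s | 1 / 2 < s i}

lemma sum_fin_three_cyclic (f : Fin 3 → ℝ) (i : Fin 3) :
    ∑ c, f c = f i + f (i + 1) + f (i + 2) := by
  rw [← Equiv.sum_comp (Equiv.addLeft i) f, Fin.sum_univ_three]
  simp only [Equiv.coe_addLeft, add_zero]

lemma fin_three_eq_cyclic (i c : Fin 3) : c = i ∨ c = i + 1 ∨ c = i + 2 := by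
  decide +revert

lemma sum_negMulLog_add_sq_le {p q r : ℝ} (hp : 1 / 3 ≤ p) (hq : 0 ≤ q) (hr : 0 ≤ r)
    (hsum : p + q + r = 1) :
    negMulLog p + negMulLog q + negMulLog r + 2 * log 2 * (p * p + q * q + r * r) ≤
      criticalPressure - 1 / 300 * ((|p - 1 / 2| - 1 / 6) ^ 2 + ((q - r) / 2) ^ 2) := by
  have hdominant := binEntropy_le_double_well (p := p) ⟨by linarith, by linarith⟩
  have hrest := negMulLog_add_le hq hr
  have htransverse : 3 / 4 * (q - r) ^ 2 ≤ (q - r) ^ 2 / (2 * (q + r)) := by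
    rcases (add_nonneg hq hr).eq_or_lt with h0 | hpos
    · obtain ⟨rfl, rfl⟩ : q = 0 ∧ r = 0 := ⟨by linarith, by linarith⟩
      simp
    · rw [le_div_iff₀ (by positivity)]
      nlinarith [sq_nonneg (q - r)]
  have hcoeff : (q - r) ^ 2 * (log 2 + 1 / 1200 - 3 / 4) ≤ 0 :=
    mul_nonpos_of_nonneg_of_nonpos (sq_nonneg _) (by linarith [log_two_lt_d9])
  obtain rfl : p = 1 - (q + r) := by linarith
  rw [binEntropy_one_sub, binEntropy_eq_negMulLog_add_negMulLog_one_sub] at hdominant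
  unfold criticalPressure
  linarith

lemma freeEnergy_le_of_third_le {s : Fin 3 → ℝ} (hs : s ∈ stdSimplex ℝ (Fin 3)) {i : Fin 3}
    (hi : 1 / 3 ≤ s i) :
    freeEnergy criticalBeta s ≤ criticalPressure -
      1 / 300 * ((|s i - 1 / 2| - 1 / 6) ^ 2 + ((s (i + 1) - s (i + 2)) / 2) ^ 2) := by
  have hsum := hs.2
  rw [sum_fin_three_cyclic _ i] at hsum
  unfold freeEnergy criticalBeta dotProduct
  rw [sum_fin_three_cyclic _ i, sum_fin_three_cyclic _ i]
  linarith [sum_negMulLog_add_sq_le hi (hs.1 (i + 1)) (hs.1 (i + 2)) hsum]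

lemma sq_dist_le_of_symmetric {s t : Fin 3 → ℝ} (hs : s ∈ stdSimplex ℝ (Fin 3))
    (ht : t ∈ stdSimplex ℝ (Fin 3)) {i : Fin 3} (hsymm : t (i + 1) = t (i + 2)) :
    dist s t ^ 2 ≤ 2 * ((s i - t i) ^ 2 + ((s (i + 1) - s (i + 2)) / 2) ^ 2) := by
  have hs1 := hs.2
  have ht1 := ht.2
  rw [sum_fin_three_cyclic _ i] at hs1 ht1
  refine (Real.le_sqrt dist_nonneg (by positivity)).1
    ((dist_pi_le_iff (Real.sqrt_nonneg _)).2 fun c => Real.abs_le_sqrt ?_)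
  set a := s i - t i with ha
  set b := (s (i + 1) - s (i + 2)) / 2 with hb
  have hb0 : 0 ≤ b ^ 2 := sq_nonneg b
  rcases fin_three_eq_cyclic i c with rfl | rfl | rfl
  · nlinarith [sq_nonneg a]
  · rw [show s (i + 1) - t (i + 1) = b - a / 2 by linarith]
    nlinarith [sq_nonneg (b + a)]
  · rw [show s (i + 2) - t (i + 2) = -b - a / 2 by linarith]
    nlinarith [sq_nonneg (b - a)]

lemma center_some_self (i : Fin 3) : center (some i) i = 2 / 3 := if_pos rfl

lemma center_some_add_one (i : Fin 3) : center (some i) (i + 1) = 1 / 6 :=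
  if_neg (by decide +revert)

lemma center_some_add_two (i : Fin 3) : center (some i) (i + 2) = 1 / 6 :=
  if_neg (by decide +revert)

lemma center_mem_stdSimplex (r : Phase) : center r ∈ stdSimplex ℝ (Fin 3) := by
  refine ⟨fun c => ?_, ?_⟩
  · rcases r with _ | i <;> simp only [center]
    · norm_num
    · split_ifs <;> norm_num
  · rcases r with _ | i
    · norm_num [center]
    · rw [sum_fin_three_cyclic _ i, center_some_self, center_some_add_one, center_some_add_two]
      norm_num

lemma exists_third_le {s : Fin 3 → ℝ} (hs : s ∈ stdSimplex ℝ (Fin 3)) : ∃ i, 1 / 3 ≤ s i := by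
  by_contra! h
  have hsum := hs.2
  rw [Fin.sum_univ_three] at hsum
  linarith [h 0, h 1, h 2]

lemma freeEnergy_le_of_mem_basin {s : Fin 3 → ℝ} (hs : s ∈ stdSimplex ℝ (Fin 3)) {r : Phase}
    (hr : s ∈ basin r) :
    freeEnergy criticalBeta s ≤ criticalPressure - dist s (center r) ^ 2 / 600 := by
  obtain ⟨i, hi, hsymm, hcenter⟩ : ∃ i, 1 / 3 ≤ s i ∧ center r (i + 1) = center r (i + 2) ∧
      (|s i - 1 / 2| - 1 / 6) ^ 2 = (s i - center r i) ^ 2 := by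
    rcases r with _ | i
    · obtain ⟨i, hi⟩ := exists_third_le hs
      refine ⟨i, hi, rfl, ?_⟩
      rw [abs_of_nonpos (sub_nonpos.2 (hr i)), center]
      ring
    · have hi : 1 / 2 < s i := hr
      refine ⟨i, by linarith, by rw [center_some_add_one, center_some_add_two], ?_⟩
      rw [abs_of_pos (by linarith), center_some_self]
      ring
  have henergy := freeEnergy_le_of_third_le hs hi
  have hdist := sq_dist_le_of_symmetric hs (center_mem_stdSimplex r) hsymm
  rw [hcenter] at henergy
  linarith

lemma exists_mem_basin (s : Fin 3 → ℝ) : ∃ r, s ∈ basin r := by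
  by_cases h : ∀ i, s i ≤ 1 / 2
  · exact ⟨none, h⟩
  · push Not at h
    exact h.imp' some fun _ => id

lemma eq_of_mem_basin {s : Fin 3 → ℝ} (hs : s ∈ stdSimplex ℝ (Fin 3)) {r r' : Phase}
    (hr : s ∈ basin r) (hr' : s ∈ basin r') : r = r' := by
  rcases r with _ | i <;> rcases r' with _ | j
  · rfl
  · exact absurd (hr j) (not_le.2 hr')
  · exact absurd (hr' i) (not_le.2 hr)
  · by_contra hij
    have hle := hs.2 ▸ Finset.add_le_sum (fun c _ => hs.1 c) (mem_univ i) (mem_univ j)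
      fun h => hij (congrArg some h)
    have hi : 1 / 2 < s i := hr
    have hj : 1 / 2 < s j := hr'
    linarith

lemma mem_basin_of_dist_lt {s : Fin 3 → ℝ} {r : Phase} (h : dist s (center r) < 1 / 6) :
    s ∈ basin r := by
  have hcoord (c : Fin 3) : |s c - center r c| < 1 / 6 := (dist_le_pi_dist s _ c).trans_lt h
  rcases r with _ | i
  · intro c
    have := (abs_lt.1 (hcoord c)).2
    simp only [center] at this
    linarith
  · have := (abs_lt.1 (hcoord i)).1
    rw [center_some_self] at this
    change 1 / 2 < s i
    linarith

lemma isMeanFieldSolution_center (r : Phase) :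
    IsMeanFieldSolution criticalBeta criticalPressure (center r) where
  mem_stdSimplex := center_mem_stdSimplex r
  exp_eq c := by
    have hpos : 0 < center r c := by
      rcases r with _ | i <;> simp only [center] <;> [skip; split_ifs] <;> norm_num
    have h13 : log (1 / 3) = -log 3 := by rw [one_div, log_inv]
    have h23 : log (2 / 3) = log 2 - log 3 := log_div (by norm_num) (by norm_num)
    have h16 : log (1 / 6) = -log 2 - log 3 := by
      rw [one_div, log_inv, show (6 : ℝ) = 2 * 3 by norm_num, log_mul (by norm_num) (by norm_num)]
      ring
    rw [← exp_log hpos, ← exp_add, exp_log hpos]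
    congr 1
    unfold criticalBeta criticalPressure dotProduct
    rcases r with _ | i
    · simp only [center, Fin.sum_univ_three, h13]
      ring
    · rw [sum_fin_three_cyclic _ i]
      rcases fin_three_eq_cyclic i c with rfl | rfl | rfl <;>
        simp only [center_some_self, center_some_add_one, center_some_add_two, h23, h16] <;> ring

end FreeEnergy

/-! ## Adding a spin and exchanging a spin, to second order -/

section LocalExpansion

variable {ι : Type*} [Fintype ι]

/-- The squared Euclidean distance; the metric that `ι → ℝ` carries is the supremum distance. -/
def sqDist (y z : ι → ℝ) : ℝ := (y - z) ⬝ᵥ (y - z)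

lemma sqDist_nonneg (y z : ι → ℝ) : 0 ≤ sqDist y z := sum_nonneg fun _ _ => mul_self_nonneg _

lemma sq_dist_le_sqDist (y z : ι → ℝ) : dist y z ^ 2 ≤ sqDist y z := by
  refine (Real.le_sqrt dist_nonneg (sqDist_nonneg y z)).1 ((dist_pi_le_iff (sqrt_nonneg _)).2 ?_)
  refine fun c => Real.abs_le_sqrt ?_
  rw [sq]
  exact single_le_sum (f := fun i => (y - z) i * (y - z) i)
    (fun i _ => mul_self_nonneg _) (mem_univ c)

lemma sum_mul_le_of_mem_stdSimplex {p f : ι → ℝ} {B : ℝ} (hp : p ∈ stdSimplex ℝ ι)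
    (hf : ∀ c, f c ≤ B) : ∑ c, p c * f c ≤ B :=
  calc ∑ c, p c * f c ≤ ∑ c, p c * B := by gcongr with c; exacts [hp.1 c, hf c]
    _ = B := by rw [← sum_mul, hp.2, one_mul]

lemma le_sum_mul_of_mem_stdSimplex {p f : ι → ℝ} {B : ℝ} (hp : p ∈ stdSimplex ℝ ι)
    (hf : ∀ c, B ≤ f c) : B ≤ ∑ c, p c * f c :=
  calc B = ∑ c, p c * B := by rw [← sum_mul, hp.2, one_mul]
    _ ≤ ∑ c, p c * f c := by gcongr with c; exacts [hp.1 c, hf c]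

lemma abs_sum_mul_le_of_mem_stdSimplex {p f : ι → ℝ} {B : ℝ} (hp : p ∈ stdSimplex ℝ ι)
    (hf : ∀ c, |f c| ≤ B) : |∑ c, p c * f c| ≤ B :=
  abs_le.2 ⟨le_sum_mul_of_mem_stdSimplex hp fun c => (abs_le.1 (hf c)).1,
    sum_mul_le_of_mem_stdSimplex hp fun c => (abs_le.1 (hf c)).2⟩

lemma abs_sub_le_one_of_mem_stdSimplex {m s : ι → ℝ} (hm : m ∈ stdSimplex ℝ ι)
    (hs : s ∈ stdSimplex ℝ ι) (c : ι) : |s c - m c| ≤ 1 := by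
  have hs' := mem_Icc_of_mem_stdSimplex hs c
  have hm' := mem_Icc_of_mem_stdSimplex hm c
  exact abs_le.2 ⟨by linarith [hs'.1, hm'.2], by linarith [hs'.2, hm'.1]⟩

lemma sqDist_mem_Icc {y z : ι → ℝ} (hy : y ∈ stdSimplex ℝ ι) (hz : z ∈ stdSimplex ℝ ι) :
    sqDist y z ∈ Set.Icc 0 2 := by
  have hself {p : ι → ℝ} (hp : p ∈ stdSimplex ℝ ι) : p ⬝ᵥ p ≤ 1 :=
    sum_mul_le_of_mem_stdSimplex hp fun c => (mem_Icc_of_mem_stdSimplex hp c).2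
  have hcross : 0 ≤ y ⬝ᵥ z := sum_nonneg fun c _ => mul_nonneg (hy.1 c) (hz.1 c)
  refine ⟨sqDist_nonneg y z, ?_⟩
  rw [sqDist, sub_dotProduct, dotProduct_sub, dotProduct_sub, dotProduct_comm z y]
  linarith [hself hy, hself hz]

lemma sqDist_le_card_mul_sq {y z : ι → ℝ} {δ : ℝ} (h : ∀ c, |y c - z c| ≤ δ) :
    sqDist y z ≤ Fintype.card ι * δ ^ 2 := by
  calc sqDist y z ≤ ∑ _c : ι, δ ^ 2 := by
        refine sum_le_sum fun c _ => ?_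
        rw [← sq, Pi.sub_apply, ← sq_abs]
        gcongr
        exact h c
    _ = _ := by simp

lemma abs_exp_sub_taylor_two_le (u : ℝ) :
    |exp u - (1 + u + u ^ 2 / 2)| ≤ |u| ^ 3 * exp |u| := by
  have h := Complex.norm_exp_sub_sum_le_norm_mul_exp (u : ℂ) 3
  have hcast : Complex.exp (u : ℂ) - ∑ m ∈ Finset.range 3, (u : ℂ) ^ m / (m.factorial : ℂ) =
      ((exp u - (1 + u + u ^ 2 / 2) : ℝ) : ℂ) := by
    simp [Finset.sum_range_succ, Nat.factorial]
  rwa [hcast, Complex.norm_real, Complex.norm_real] at h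

/-- The constant in the second-order Taylor estimate `abs_exp_add_sub_le`. -/
def taylorConst (A : ℝ) : ℝ := (2 * A) ^ 3 * exp (2 * A) + 2 * A ^ 2

lemma abs_exp_add_sub_le {A δ v w : ℝ} (hδ : δ ∈ Set.Icc 0 1) (hv : |v| ≤ A * δ)
    (hw : |w| ≤ A * δ ^ 2) :
    |exp (v + w) - (1 + (v + w + v ^ 2 / 2))| ≤ taylorConst A * δ ^ 3 := by
  obtain ⟨hδ0, hδ1⟩ := hδ
  rcases hδ0.eq_or_lt with rfl | hpos
  · obtain ⟨rfl, rfl⟩ : v = 0 ∧ w = 0 := by simpa using And.intro hv hw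
    simp
  have hA : 0 ≤ A := nonneg_of_mul_nonneg_left ((abs_nonneg v).trans hv) hpos
  have hsum : |v + w| ≤ 2 * A * δ := by
    have := mul_le_mul_of_nonneg_left (pow_le_of_le_one hδ0 hδ1 two_ne_zero) hA
    linarith [abs_add_le v w]
  have hexp : |v + w| ^ 3 * exp |v + w| ≤ (2 * A * δ) ^ 3 * exp (2 * A) := by
    have : |v + w| ≤ 2 * A := hsum.trans (mul_le_of_le_one_right (by positivity) hδ1)
    gcongr
  have hrest : |v * w + w ^ 2 / 2| ≤ 2 * A ^ 2 * δ ^ 3 := by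
    have hvw : |v * w| ≤ A * δ * (A * δ ^ 2) := by
      rw [abs_mul]; gcongr
    have hww : |w ^ 2 / 2| ≤ (A * δ ^ 2) * (A * δ ^ 2) / 2 := by
      rw [abs_div, abs_two, sq, abs_mul]; gcongr
    have hδ4 : A ^ 2 * δ ^ 4 ≤ A ^ 2 * δ ^ 3 := by
      gcongr ?_ * ?_
      exact pow_le_pow_of_le_one hδ0 hδ1 (by norm_num)
    nlinarith [abs_add_le (v * w) (w ^ 2 / 2), show 0 ≤ A ^ 2 * δ ^ 3 by positivity]
  calc |exp (v + w) - (1 + (v + w + v ^ 2 / 2))|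
      = |(exp (v + w) - (1 + (v + w) + (v + w) ^ 2 / 2)) + (v * w + w ^ 2 / 2)| := by
        congr 1; ring
    _ ≤ _ := abs_add_le _ _
    _ ≤ (2 * A * δ) ^ 3 * exp (2 * A) + 2 * A ^ 2 * δ ^ 3 :=
        add_le_add ((abs_exp_sub_taylor_two_le _).trans hexp) hrest
    _ = _ := by rw [taylorConst]; ring

lemma abs_sum_mul_exp_add_sub_le {A δ : ℝ} {p v w : ι → ℝ} (hp : p ∈ stdSimplex ℝ ι)
    (hδ : δ ∈ Set.Icc 0 1) (hv : ∀ c, |v c| ≤ A * δ) (hw : ∀ c, |w c| ≤ A * δ ^ 2) :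
    |∑ c, p c * exp (v c + w c) - (1 + ∑ c, p c * (v c + w c + v c ^ 2 / 2))| ≤
      taylorConst A * δ ^ 3 := by
  have h := abs_sum_mul_le_of_mem_stdSimplex hp fun c => abs_exp_add_sub_le hδ (hv c) (hw c)
  simp only [mul_sub, mul_add _ (1 : ℝ), mul_one, sum_sub_distrib] at h
  rwa [sum_add_distrib, hp.2] at h

lemma prod_mem_stdSimplex {p q : ι → ℝ} (hp : p ∈ stdSimplex ℝ ι) (hq : q ∈ stdSimplex ℝ ι) :
    (fun e : ι × ι => p e.1 * q e.2) ∈ stdSimplex ℝ (ι × ι) := by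
  refine ⟨fun e => mul_nonneg (hp.1 _) (hq.1 _), ?_⟩
  rw [Fintype.sum_prod_type]
  simp only [← mul_sum, hq.2, mul_one, hp.2]

lemma sum_mul_exp_mem_Icc {p u : ι → ℝ} {B : ℝ} (hp : p ∈ stdSimplex ℝ ι) (hu : ∀ c, |u c| ≤ B) :
    ∑ c, p c * exp (u c) ∈ Set.Icc (exp (-B)) (exp B) :=
  ⟨le_sum_mul_of_mem_stdSimplex hp fun c => exp_le_exp.2 (abs_le.1 (hu c)).1,
    sum_mul_le_of_mem_stdSimplex hp fun c => exp_le_exp.2 (abs_le.1 (hu c)).2⟩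

lemma abs_two_mul_mul_sub_le {β δ a b : ℝ} (hβ : 0 ≤ β) (ha : |a| ≤ δ) (hb : |b| ≤ δ) :
    |2 * β * (a - b)| ≤ 4 * β * δ := by
  rw [abs_mul, abs_of_nonneg (by positivity)]
  nlinarith [abs_sub a b]

lemma abs_mul_mul_sub_le {β ε t q b B : ℝ} (hβ : 0 ≤ β) (hε : ε ∈ Set.Icc 0 t)
    (hq : q ∈ Set.Icc 0 2) (hb : b ∈ Set.Icc 0 B) : |β * (ε * q - b)| ≤ β * (2 * t + B) := by
  rw [abs_mul, abs_of_nonneg hβ]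
  gcongr
  have hmul : ε * q ≤ t * 2 := mul_le_mul hε.2 hq.2 hq.1 (hε.1.trans hε.2)
  rw [abs_le]
  constructor <;> linarith [mul_nonneg hε.1 hq.1, hb.1, hb.2]

lemma abs_second_order_residual_le {β : ℝ} (hβ : 0 ≤ β) {m s : ι → ℝ} (hm : m ∈ stdSimplex ℝ ι)
    (hs : s ∈ stdSimplex ℝ ι) {δ η ε : ℝ} (hdist : dist s m ≤ δ) (hε : ε ∈ Set.Icc 0 (δ ^ 2))
    (hηε : |η - ε| ≤ δ ^ 3) :
    |2 * β * (η - ε) * (1 - s ⬝ᵥ m) - 2 * β * ε * (s ⬝ᵥ (s - m)) +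
      2 * β ^ 2 * (∑ c, (s - m) c * (s - m) c ^ 2 - 2 * (m ⬝ᵥ (s - m)) * sqDist s m)| ≤
      (4 * β + 6 * β ^ 2 * Fintype.card ι) * δ ^ 3 := by
  have hδ : 0 ≤ δ := dist_nonneg.trans hdist
  have hx : ∀ c, |(s - m) c| ≤ δ := (dist_pi_le_iff hδ).1 hdist
  have hself : |1 - s ⬝ᵥ m| ≤ 1 := by
    have h0 : 0 ≤ s ⬝ᵥ m := sum_nonneg fun c _ => mul_nonneg (hs.1 c) (hm.1 c)
    have h1 : s ⬝ᵥ m ≤ 1 :=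
      sum_mul_le_of_mem_stdSimplex hs fun c => (mem_Icc_of_mem_stdSimplex hm c).2
    exact abs_le.2 ⟨by linarith, by linarith⟩
  have hcubic : |∑ c, (s - m) c * (s - m) c ^ 2| ≤ Fintype.card ι * δ ^ 3 := by
    calc _ ≤ ∑ c, |(s - m) c * (s - m) c ^ 2| := abs_sum_le_sum_abs _ _
      _ ≤ ∑ _c : ι, δ ^ 3 := by
        refine sum_le_sum fun c _ => ?_
        rw [← pow_succ', abs_pow]
        exact pow_le_pow_left₀ (abs_nonneg _) (hx c) 3
      _ = _ := by simp
  have hε' : |ε| ≤ δ ^ 2 := by rw [abs_of_nonneg hε.1]; exact hε.2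
  have hsq : |sqDist s m| ≤ Fintype.card ι * δ ^ 2 := by
    rw [abs_of_nonneg (sqDist_nonneg s m)]; exact sqDist_le_card_mul_sq hx
  calc _ ≤ |2 * β * (η - ε) * (1 - s ⬝ᵥ m)| + |2 * β * ε * (s ⬝ᵥ (s - m))| +
        |2 * β ^ 2 * (∑ c, (s - m) c * (s - m) c ^ 2 - 2 * (m ⬝ᵥ (s - m)) * sqDist s m)| :=
        (abs_add_le _ _).trans (add_le_add_left (abs_sub _ _) _)
    _ ≤ 2 * β * δ ^ 3 * 1 + 2 * β * δ ^ 2 * δ +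
        2 * β ^ 2 * (Fintype.card ι * δ ^ 3 + 2 * δ * (Fintype.card ι * δ ^ 2)) := by
        simp only [abs_mul, abs_two, abs_of_nonneg hβ, abs_of_nonneg (sq_nonneg β)]
        gcongr
        · exact abs_sum_mul_le_of_mem_stdSimplex hs hx
        · refine (abs_sub _ _).trans (add_le_add hcubic ?_)
          rw [abs_mul, abs_mul, abs_two]
          gcongr
          exact abs_sum_mul_le_of_mem_stdSimplex hm hx
    _ = _ := by ring

variable [DecidableEq ι]

/-- Up to a factor `exp P`, the factor by which one more spin, summed over its colours, multiplies
the weight of a configuration of profile `s`. Here `m` is a mean-field solution, and `ε` is the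
inverse of the new number of spins. -/
def stepFactor (β ε : ℝ) (m s : ι → ℝ) : ℝ :=
  ∑ c, m c * exp (2 * β * ((s - m) c - m ⬝ᵥ (s - m)) +
    β * (ε * sqDist (Pi.single c 1) s - sqDist s m))

/-- The factor by which the weight of a configuration of profile `s` is multiplied when a uniformly
chosen spin, of colour `d`, is given the colour `c`, summed against `m d` over the colours. Here
`m` is a mean-field solution, and `η` is the inverse of the number of spins. -/
def exchangeFactor (β η : ℝ) (m s : ι → ℝ) : ℝ :=
  ∑ d, ∑ c, s d * m c * exp (2 * β * ((s - m) c - (s - m) d) +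
    β * (η * sqDist (Pi.single c 1) (Pi.single d 1)))

lemma sqDist_single (c : ι) (y : ι → ℝ) :
    sqDist (Pi.single c 1) y = 1 - 2 * y c + y ⬝ᵥ y := by
  rw [sqDist, sub_dotProduct, dotProduct_sub, dotProduct_sub, single_one_dotProduct,
    single_one_dotProduct, dotProduct_single_one, Pi.single_eq_same]
  ring

lemma sum_mul_second_order {p : ι → ℝ} (hp : p ∈ stdSimplex ℝ ι) (β η a b : ℝ) (x y : ι → ℝ) :
    ∑ c, p c * (2 * β * (x c - a) + β * (η * sqDist (Pi.single c 1) y - b) +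
        (2 * β * (x c - a)) ^ 2 / 2) =
      2 * β * (p ⬝ᵥ x - a) + β * (η * (1 - 2 * (p ⬝ᵥ y) + y ⬝ᵥ y) - b) +
        2 * β ^ 2 * (p ⬝ᵥ x ^ 2 - 2 * a * (p ⬝ᵥ x) + a ^ 2) := by
  calc _ = ∑ c, ((β * (η * (1 + y ⬝ᵥ y) - b) - 2 * β * a + 2 * β ^ 2 * a ^ 2) * p c +
        (2 * β - 4 * β ^ 2 * a) * (p c * x c) - 2 * β * η * (p c * y c) +
          2 * β ^ 2 * (p c * (x ^ 2) c)) := by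
        refine sum_congr rfl fun c _ => ?_
        rw [sqDist_single, Pi.pow_apply]
        ring
    _ = _ := by
        simp only [sum_add_distrib, sum_sub_distrib, ← mul_sum, hp.2]
        simp only [dotProduct]
        ring

/-- Every term of first or second order in `s - m` cancels: the right-hand side is of third order as
soon as `η - ε` is. -/
lemma exchange_sub_two_mul_step_second_order {m s : ι → ℝ} (hm : m ∈ stdSimplex ℝ ι)
    (hs : s ∈ stdSimplex ℝ ι) (β η ε : ℝ) :
    (∑ d, ∑ c, s d * m c * (2 * β * ((s - m) c - (s - m) d) +
        β * (η * sqDist (Pi.single c 1) (Pi.single d 1)) +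
        (2 * β * ((s - m) c - (s - m) d)) ^ 2 / 2)) -
      2 * ∑ c, m c * (2 * β * ((s - m) c - m ⬝ᵥ (s - m)) +
        β * (ε * sqDist (Pi.single c 1) s - sqDist s m) +
        (2 * β * ((s - m) c - m ⬝ᵥ (s - m))) ^ 2 / 2) =
      2 * β * (η - ε) * (1 - s ⬝ᵥ m) - 2 * β * ε * (s ⬝ᵥ (s - m)) +
        2 * β ^ 2 * (∑ c, (s - m) c * (s - m) c ^ 2 - 2 * (m ⬝ᵥ (s - m)) * sqDist s m) := by
  set x := s - m with hx
  have hinner (d : ι) := sum_mul_second_order hm β η (x d) 0 x (Pi.single d 1)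
  simp only [sub_zero, dotProduct_single_one, Pi.single_eq_same] at hinner
  have houter : ∑ d, s d * (2 * β * (m ⬝ᵥ x - x d) + β * (η * (1 - 2 * m d + 1)) +
        2 * β ^ 2 * (m ⬝ᵥ x ^ 2 - 2 * x d * (m ⬝ᵥ x) + x d ^ 2)) =
      2 * β * (m ⬝ᵥ x - s ⬝ᵥ x) + 2 * β * η * (1 - s ⬝ᵥ m) +
        2 * β ^ 2 * (m ⬝ᵥ x ^ 2 - 2 * (s ⬝ᵥ x) * (m ⬝ᵥ x) + s ⬝ᵥ x ^ 2) := by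
    calc _ = ∑ d, ((2 * β * (m ⬝ᵥ x) + 2 * β * η + 2 * β ^ 2 * (m ⬝ᵥ x ^ 2)) * s d -
          (2 * β + 4 * β ^ 2 * (m ⬝ᵥ x)) * (s d * x d) - 2 * β * η * (s d * m d) +
            2 * β ^ 2 * (s d * (x ^ 2) d)) := by
          refine sum_congr rfl fun d _ => ?_
          rw [Pi.pow_apply]
          ring
      _ = _ := by
          simp only [sum_add_distrib, sum_sub_distrib, ← mul_sum, hs.2]
          simp only [dotProduct]
          ring
  have hsx (f : ι → ℝ) : s ⬝ᵥ f = m ⬝ᵥ f + x ⬝ᵥ f := by rw [← add_dotProduct, hx, add_sub_cancel]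
  have hcubic : x ⬝ᵥ x ^ 2 = ∑ c, x c * x c ^ 2 := rfl
  have hself : s ⬝ᵥ s = s ⬝ᵥ m + s ⬝ᵥ x := by rw [← dotProduct_add, hx, add_sub_cancel]
  have hdist : sqDist s m = x ⬝ᵥ x := rfl
  simp only [mul_assoc (s _), ← mul_sum, hinner, houter]
  rw [sum_mul_second_order hm, hdist, ← hcubic, hsx x, hsx (x ^ 2), dotProduct_comm m s, hself,
    hsx x]
  ring

lemma exists_abs_exchangeFactor_add_one_sub_le {β : ℝ} (hβ : 0 ≤ β) :
    ∃ C, 0 ≤ C ∧ ∀ {m s : ι → ℝ}, m ∈ stdSimplex ℝ ι → s ∈ stdSimplex ℝ ι →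
      ∀ {δ η ε : ℝ}, dist s m ≤ δ → δ ≤ 1 → η ∈ Set.Icc 0 (δ ^ 2) → ε ∈ Set.Icc 0 (δ ^ 2) →
        |η - ε| ≤ δ ^ 3 →
          |exchangeFactor β η m s + 1 - 2 * stepFactor β ε m s| ≤ C * δ ^ 3 := by
  have hN : (0 : ℝ) ≤ Fintype.card ι := Nat.cast_nonneg _
  set N := (Fintype.card ι : ℝ)
  set A : ℝ := (4 + N) * β with hA
  refine ⟨3 * taylorConst A + (4 * β + 6 * β ^ 2 * N), by unfold taylorConst; positivity, ?_⟩
  intro m s hm hs δ η ε hdist hδ1 hη hε hηε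
  have hδ0 : 0 ≤ δ := dist_nonneg.trans hdist
  have hx : ∀ c, |(s - m) c| ≤ δ := (dist_pi_le_iff hδ0).1 hdist
  have hmean : |m ⬝ᵥ (s - m)| ≤ δ := abs_sum_mul_le_of_mem_stdSimplex hm hx
  have hfirst : 4 * β * δ ≤ A * δ := by rw [hA]; gcongr; linarith [mul_nonneg hN hβ]
  have hsecond {B : ℝ} (hB : B ≤ N * δ ^ 2) : β * (2 * δ ^ 2 + B) ≤ A * δ ^ 2 := by
    have h : 2 * δ ^ 2 + B ≤ (4 + N) * δ ^ 2 := by linarith [sq_nonneg δ]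
    calc β * (2 * δ ^ 2 + B) ≤ β * ((4 + N) * δ ^ 2) := by gcongr
      _ = A * δ ^ 2 := by rw [hA]; ring
  have hstep : |stepFactor β ε m s - (1 + _)| ≤ taylorConst A * δ ^ 3 :=
    abs_sum_mul_exp_add_sub_le hm ⟨hδ0, hδ1⟩
      (fun c => (abs_two_mul_mul_sub_le hβ (hx c) hmean).trans hfirst)
      (fun c => (abs_mul_mul_sub_le hβ hε (sqDist_mem_Icc (single_mem_stdSimplex ℝ c) hs)
        ⟨sqDist_nonneg s m, sqDist_le_card_mul_sq hx⟩).trans (hsecond le_rfl))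
  have hcoupling (e : ι × ι) :
      |β * (η * sqDist (Pi.single e.2 1) (Pi.single e.1 1))| ≤ A * δ ^ 2 := by
    have h := abs_mul_mul_sub_le hβ hη (sqDist_mem_Icc (single_mem_stdSimplex ℝ e.2)
      (single_mem_stdSimplex ℝ e.1)) (Set.left_mem_Icc.2 le_rfl)
    rw [sub_zero] at h
    exact h.trans (hsecond (by positivity))
  have hexchange := abs_sum_mul_exp_add_sub_le (prod_mem_stdSimplex hs hm) ⟨hδ0, hδ1⟩
    (fun e => (abs_two_mul_mul_sub_le hβ (hx e.2) (hx e.1)).trans hfirst) hcoupling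
  simp only [Fintype.sum_prod_type] at hexchange
  change |exchangeFactor β η m s - (1 + _)| ≤ _ at hexchange
  have hresidual := abs_second_order_residual_le hβ hm hs hdist hε hηε
  rw [← exchange_sub_two_mul_step_second_order hm hs β η ε] at hresidual
  rw [abs_le] at hstep hexchange hresidual ⊢
  constructor <;> linarith

lemma stepFactor_mem_Icc {β ε : ℝ} (hβ : 0 ≤ β) {m s : ι → ℝ} (hm : m ∈ stdSimplex ℝ ι)
    (hs : s ∈ stdSimplex ℝ ι) (hε : ε ∈ Set.Icc 0 1) :
    stepFactor β ε m s ∈ Set.Icc (exp (-(8 * β))) (exp (8 * β)) := by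
  have hx := abs_sub_le_one_of_mem_stdSimplex hm hs
  refine sum_mul_exp_mem_Icc hm fun c => ?_
  calc _ ≤ _ := abs_add_le _ _
    _ ≤ 4 * β * 1 + β * (2 * 1 + 2) :=
        add_le_add
          (abs_two_mul_mul_sub_le hβ (hx c) (abs_sum_mul_le_of_mem_stdSimplex hm hx))
          (abs_mul_mul_sub_le hβ hε (sqDist_mem_Icc (single_mem_stdSimplex ℝ c) hs)
            (sqDist_mem_Icc hs hm))
    _ = 8 * β := by ring

lemma exchangeFactor_mem_Icc {β η : ℝ} (hβ : 0 ≤ β) {m s : ι → ℝ} (hm : m ∈ stdSimplex ℝ ι)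
    (hs : s ∈ stdSimplex ℝ ι) (hη : η ∈ Set.Icc 0 1) :
    exchangeFactor β η m s ∈ Set.Icc (exp (-(8 * β))) (exp (8 * β)) := by
  have hx := abs_sub_le_one_of_mem_stdSimplex hm hs
  have h := sum_mul_exp_mem_Icc (B := 8 * β) (prod_mem_stdSimplex hs hm)
    (u := fun e => 2 * β * ((s - m) e.2 - (s - m) e.1) +
      β * (η * sqDist (Pi.single e.2 1) (Pi.single e.1 1))) fun e => ?_
  · rwa [Fintype.sum_prod_type] at h
  have hsecond := abs_mul_mul_sub_le hβ hη (sqDist_mem_Icc (single_mem_stdSimplex ℝ e.2)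
    (single_mem_stdSimplex ℝ e.1)) (b := 0) (B := 2) (by norm_num)
  rw [sub_zero] at hsecond
  calc _ ≤ _ := abs_add_le _ _
    _ ≤ 4 * β * 1 + β * (2 * 1 + 2) :=
        add_le_add (abs_two_mul_mul_sub_le hβ (hx e.2) (hx e.1)) hsecond
    _ = 8 * β := by ring

lemma abs_exchangeFactor_add_one_sub_le {β η ε : ℝ} (hβ : 0 ≤ β) {m s : ι → ℝ}
    (hm : m ∈ stdSimplex ℝ ι) (hs : s ∈ stdSimplex ℝ ι) (hη : η ∈ Set.Icc 0 1)
    (hε : ε ∈ Set.Icc 0 1) :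
    |exchangeFactor β η m s + 1 - 2 * stepFactor β ε m s| ≤ 2 * exp (8 * β) := by
  have hexchange := exchangeFactor_mem_Icc hβ hm hs hη
  have hstep := stepFactor_mem_Icc hβ hm hs hε
  have := one_le_exp (x := 8 * β) (by positivity)
  have := exp_pos (-(8 * β))
  exact abs_le.2 ⟨by linarith [hexchange.1, hstep.2], by linarith [hexchange.2, hstep.1]⟩

end LocalExpansion

/-! ## Weights of configurations -/

section Weights

variable {k : ℕ}

lemma smul_colourRatio (σ : Config k) : (k : ℝ) • colourRatio σ = ∑ l, Pi.single (σ l) 1 := by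
  funext i
  rcases k.eq_zero_or_pos with rfl | hk
  · simp
  · have hcount : ∑ l, (Pi.single (σ l) 1 : Fin 3 → ℝ) i = colourCount σ i := by
      simp [colourCount, Pi.single_apply, sum_boole, eq_comm]
    rw [Finset.sum_apply, hcount, Pi.smul_apply, colourRatio, smul_eq_mul,
      mul_div_cancel₀ _ (by positivity)]

lemma colourRatio_eq (σ : Config k) : colourRatio σ = (k : ℝ)⁻¹ • ∑ l, Pi.single (σ l) 1 := by
  rcases k.eq_zero_or_pos with rfl | hk
  · funext i
    simp [colourRatio]
  · rw [← smul_colourRatio, inv_smul_smul₀ (by positivity)]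

lemma sum_apply_spin (σ : Config k) (φ : Fin 3 → ℝ) :
    ∑ l, φ (σ l) = k * (colourRatio σ ⬝ᵥ φ) := by
  rw [← smul_eq_mul, ← smul_dotProduct, smul_colourRatio, sum_dotProduct]
  simp only [single_one_dotProduct]

lemma colourRatio_mem_stdSimplex (hk : 0 < k) (σ : Config k) :
    colourRatio σ ∈ stdSimplex ℝ (Fin 3) := by
  refine ⟨fun c => by unfold colourRatio; positivity, ?_⟩
  have h := sum_apply_spin σ 1
  simpa [dotProduct_one, hk.ne'] using h

lemma colourRatio_apply_spin_pos (σ : Config k) (l : Fin k) : 0 < colourRatio σ (σ l) := by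
  have hcount : 0 < colourCount σ (σ l) := card_pos.2 ⟨l, by simp⟩
  have := l.pos
  unfold colourRatio
  positivity

lemma colourRatio_snoc (σ : Config k) (c : Fin 3) :
    colourRatio (Fin.snoc σ c : Config (k + 1)) =
      colourRatio σ + ((k : ℝ) + 1)⁻¹ • (Pi.single c 1 - colourRatio σ) := by
  have h : colourRatio (Fin.snoc σ c : Config (k + 1)) =
      ((k : ℝ) + 1)⁻¹ • ((k : ℝ) • colourRatio σ + Pi.single c 1) := by
    rw [colourRatio_eq, Fin.sum_univ_castSucc, smul_colourRatio]
    simp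
  have : (k : ℝ) + 1 ≠ 0 := by positivity
  rw [h]
  match_scalars <;> field_simp
  ring

lemma colourRatio_update (σ : Config k) (l : Fin k) (c : Fin 3) :
    colourRatio (Function.update σ l c) =
      colourRatio σ + (k : ℝ)⁻¹ • (Pi.single c 1 - Pi.single (σ l) 1) := by
  rw [colourRatio_eq, colourRatio_eq σ, ← smul_add, ← add_sum_erase _ _ (mem_univ l),
    ← add_sum_erase _ (fun j => (Pi.single (σ j) 1 : Fin 3 → ℝ)) (mem_univ l), Function.update_self,
    sum_congr rfl fun j hj => by rw [Function.update_of_ne (ne_of_mem_erase hj)]]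
  congr 1
  abel

lemma weight_eq (β : ℝ) (σ : Config k) :
    weight β σ = exp (k * β * (colourRatio σ ⬝ᵥ colourRatio σ)) := by
  simp only [weight, dotProduct, sq]

lemma weight_pos (β : ℝ) (σ : Config k) : 0 < weight β σ := exp_pos _

lemma weight_snoc (β : ℝ) (σ : Config k) (c : Fin 3) :
    weight β (Fin.snoc σ c : Config (k + 1)) = weight β σ *
      exp (2 * β * colourRatio σ c - β * (colourRatio σ ⬝ᵥ colourRatio σ) +
        β * (((k : ℝ) + 1)⁻¹ * sqDist (Pi.single c 1) (colourRatio σ))) := by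
  have : (k : ℝ) + 1 ≠ 0 := by positivity
  rw [weight_eq, weight_eq, ← exp_add, colourRatio_snoc, sqDist_single]
  congr 1
  simp only [add_dotProduct, dotProduct_add, smul_dotProduct, dotProduct_smul, sub_dotProduct,
    dotProduct_sub, single_one_dotProduct, dotProduct_single_one, Pi.single_eq_same, smul_eq_mul,
    Pi.add_apply, Pi.smul_apply, Pi.sub_apply]
  push_cast
  field_simp
  ring

lemma weight_update (β : ℝ) (σ : Config k) (l : Fin k) (c : Fin 3) :
    weight β (Function.update σ l c) = weight β σ *
      exp (2 * β * (colourRatio σ c - colourRatio σ (σ l)) +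
        β * ((k : ℝ)⁻¹ * sqDist (Pi.single c 1) (Pi.single (σ l) 1))) := by
  have : (k : ℝ) ≠ 0 := Nat.cast_ne_zero.2 l.pos.ne'
  rw [weight_eq, weight_eq, ← exp_add, colourRatio_update, sqDist]
  congr 1
  simp only [add_dotProduct, dotProduct_add, smul_dotProduct, dotProduct_smul, sub_dotProduct,
    dotProduct_sub, single_one_dotProduct, dotProduct_single_one, smul_eq_mul, Pi.add_apply,
    Pi.smul_apply, Pi.sub_apply]
  field_simp
  ring

lemma weight_eq_exp_freeEnergy_mul_prod (β : ℝ) (σ : Config k) :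
    weight β σ = exp (k * freeEnergy β (colourRatio σ)) * ∏ l, colourRatio σ (σ l) := by
  have hprod : ∏ l, colourRatio σ (σ l) = exp (-(k * ∑ c, negMulLog (colourRatio σ c))) := by
    rw [← prod_congr rfl fun l _ => exp_log (colourRatio_apply_spin_pos σ l), ← exp_sum,
      sum_apply_spin σ fun c => log (colourRatio σ c)]
    simp only [dotProduct, negMulLog, neg_mul, sum_neg_distrib, mul_neg, neg_neg]
  rw [hprod, weight_eq, ← exp_add, freeEnergy]
  congr 1
  ring

variable {β P : ℝ} {m : Fin 3 → ℝ}

lemma weight_eq_prod_mul_exp (h : IsMeanFieldSolution β P m) (σ : Config k) :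
    weight β σ = exp (k * P) * (∏ l, m (σ l)) * exp (k * β * sqDist (colourRatio σ) m) := by
  have hprod : exp (k * P) * ∏ l, m (σ l) =
      exp (k * (colourRatio σ ⬝ᵥ fun c => 2 * β * m c) - k * (β * (m ⬝ᵥ m))) := by
    rw [← sum_apply_spin, exp_nat_mul, ← Fin.prod_const, ← prod_mul_distrib]
    simp only [← h.exp_eq, ← exp_sum, sum_sub_distrib]
    simp
  rw [hprod, weight_eq, ← exp_add, sqDist, sub_dotProduct, dotProduct_sub, dotProduct_sub,
    dotProduct_comm m (colourRatio σ)]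
  congr 1
  have : (colourRatio σ ⬝ᵥ fun c => 2 * β * m c) = 2 * β * (colourRatio σ ⬝ᵥ m) :=
    dotProduct_smul (2 * β) _ m
  rw [this]
  ring

lemma sum_weight_snoc (h : IsMeanFieldSolution β P m) (σ : Config k) :
    ∑ c, weight β (Fin.snoc σ c : Config (k + 1)) =
      exp P * (weight β σ * stepFactor β ((k : ℝ) + 1)⁻¹ m (colourRatio σ)) := by
  rw [mul_left_comm, stepFactor, mul_sum, mul_sum]
  refine sum_congr rfl fun c _ => ?_
  rw [weight_snoc, ← mul_assoc (exp P), ← h.exp_eq, ← exp_add]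
  congr 2
  simp only [sqDist, Pi.sub_apply, sub_dotProduct, dotProduct_sub]
  rw [dotProduct_comm m (colourRatio σ)]
  ring

/-- The factor, relative to `m d`, by which the weight of a configuration of profile `s` is
multiplied when a spin of colour `d` is given the colour `c`, weighted by `m c`. -/
def exchangeTerm (β η : ℝ) (m s : Fin 3 → ℝ) (d c : Fin 3) : ℝ :=
  m c * exp (2 * β * ((s - m) c - (s - m) d) +
    β * (η * sqDist (Pi.single c 1) (Pi.single d 1)))

lemma exchangeTerm_nonneg (hm : m ∈ stdSimplex ℝ (Fin 3)) (β η : ℝ) (s : Fin 3 → ℝ)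
    (d c : Fin 3) : 0 ≤ exchangeTerm β η m s d c :=
  mul_nonneg (hm.1 c) (exp_pos _).le

lemma weight_update_mul (h : IsMeanFieldSolution β P m) (σ : Config k) (l : Fin k) (c : Fin 3) :
    weight β (Function.update σ l c) * m (σ l) =
      weight β σ * exchangeTerm β (k : ℝ)⁻¹ m (colourRatio σ) (σ l) c := by
  refine mul_left_cancel₀ (exp_pos P).ne' ?_
  calc _ = weight β (Function.update σ l c) * (exp P * m (σ l)) := by ring
    _ = weight β σ * ((exp P * m c) * exp (2 * β *
          ((colourRatio σ - m) c - (colourRatio σ - m) (σ l)) +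
            β * ((k : ℝ)⁻¹ * sqDist (Pi.single c 1) (Pi.single (σ l) 1)))) := by
        rw [weight_update, mul_assoc, ← h.exp_eq, ← h.exp_eq, ← exp_add, ← exp_add]
        congr 2
        simp only [Pi.sub_apply]
        ring
    _ = _ := by rw [exchangeTerm]; ring

lemma sum_exchangeTerm (β : ℝ) (m : Fin 3 → ℝ) (σ : Config k) :
    ∑ l, ∑ c, exchangeTerm β (k : ℝ)⁻¹ m (colourRatio σ) (σ l) c =
      k * exchangeFactor β (k : ℝ)⁻¹ m (colourRatio σ) := by
  rw [sum_apply_spin σ fun d => ∑ c, exchangeTerm β (k : ℝ)⁻¹ m (colourRatio σ) d c,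
    exchangeFactor]
  simp only [dotProduct, exchangeTerm, mul_sum, mul_assoc]

end Weights

/-! ## Masses of events -/

section Mass

variable {k : ℕ} {β : ℝ}

/-- The unnormalised probability of the event `S` under the model with `k` spins. -/
def mass (β : ℝ) (S : Set (Config k)) : ℝ := ∑ σ, S.indicator (weight β) σ

/-- The event `S` about the first `k` spins, as an event about `k + 1` spins. -/
def extension (S : Set (Config k)) : Set (Config (k + 1)) := initialSpins k.le_succ ⁻¹' S

lemma mass_nonneg (S : Set (Config k)) : 0 ≤ mass β S :=
  sum_nonneg fun σ _ => Set.indicator_nonneg (fun σ _ => (weight_pos β σ).le) σ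

lemma mass_univ : mass β (Set.univ : Set (Config k)) = partitionFunction β k := by
  simp only [mass, Set.indicator_univ, partitionFunction]

lemma partitionFunction_pos : 0 < partitionFunction β k :=
  sum_pos (fun σ _ => weight_pos β σ) univ_nonempty

lemma sum_mass_eq_partitionFunction {α : Type*} [Fintype α] {S : α → Set (Config k)}
    (h : ∀ σ, ∃! a, σ ∈ S a) : ∑ a, mass β (S a) = partitionFunction β k := by
  simp only [mass, partitionFunction]
  rw [sum_comm]
  refine sum_congr rfl fun σ _ => ?_
  obtain ⟨a, ha, hunique⟩ := h σ
  rw [Fintype.sum_eq_single a fun b hb => Set.indicator_of_notMem (mt (hunique b) hb) _,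
    Set.indicator_of_mem ha]

lemma sum_prod_colourRatio_le (hk : 0 < k) :
    ∑ τ : Config k, ∏ l, colourRatio τ (τ l) ≤ ((k : ℝ) + 1) ^ 3 := by
  have hcount (τ : Config k) : colourCount τ ∈ Fintype.piFinset fun _ => range (k + 1) := by
    refine Fintype.mem_piFinset.2 fun c => mem_range.2 (Nat.lt_succ_of_le ?_)
    simpa [colourCount] using card_filter_le univ fun l : Fin k => τ l = c
  have hfiber (n : Fin 3 → ℕ) :
      ∑ τ : Config k with colourCount τ = n, ∏ l, colourRatio τ (τ l) ≤ 1 := by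
    rcases (univ.filter fun τ : Config k => colourCount τ = n).eq_empty_or_nonempty
      with h | ⟨τ₀, h₀⟩
    · rw [h, sum_empty]; exact zero_le_one
    have hs := colourRatio_mem_stdSimplex hk τ₀
    calc ∑ τ : Config k with colourCount τ = n, ∏ l, colourRatio τ (τ l)
        = ∑ τ : Config k with colourCount τ = n, ∏ l, colourRatio τ₀ (τ l) := by
          refine sum_congr rfl fun τ hτ => prod_congr rfl fun l _ => ?_
          rw [colourRatio, colourRatio, (mem_filter.1 hτ).2, (mem_filter.1 h₀).2]
      _ ≤ ∑ τ : Config k, ∏ l, colourRatio τ₀ (τ l) :=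
          sum_le_sum_of_subset_of_nonneg (subset_univ _)
            fun τ _ _ => prod_nonneg fun l _ => hs.1 _
      _ = 1 := by rw [← Fintype.sum_pow, hs.2, one_pow]
  calc ∑ τ : Config k, ∏ l, colourRatio τ (τ l)
      = ∑ n ∈ Fintype.piFinset fun _ : Fin 3 => range (k + 1),
          ∑ τ : Config k with colourCount τ = n, ∏ l, colourRatio τ (τ l) :=
        (sum_fiberwise_of_maps_to (fun τ _ => hcount τ) _).symm
    _ ≤ ∑ _n ∈ Fintype.piFinset fun _ : Fin 3 => range (k + 1), 1 :=
        sum_le_sum fun n _ => hfiber n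
    _ = ((k : ℝ) + 1) ^ 3 := by simp

lemma mass_le_of_freeEnergy_le (hk : 0 < k) {S : Set (Config k)} {f : ℝ}
    (hS : ∀ σ ∈ S, freeEnergy β (colourRatio σ) ≤ f) :
    mass β S ≤ ((k : ℝ) + 1) ^ 3 * exp (k * f) := by
  have hprod (σ : Config k) : 0 ≤ ∏ l, colourRatio σ (σ l) :=
    prod_nonneg fun l _ => (colourRatio_apply_spin_pos σ l).le
  calc mass β S ≤ ∑ σ, exp (k * f) * ∏ l, colourRatio σ (σ l) := by
        refine sum_le_sum fun σ _ => Set.indicator_apply_le' (fun hσ => ?_) fun _ =>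
          mul_nonneg (exp_pos _).le (hprod σ)
        rw [weight_eq_exp_freeEnergy_mul_prod]
        gcongr
        exacts [hprod σ, hS σ hσ]
    _ = exp (k * f) * ∑ σ : Config k, ∏ l, colourRatio σ (σ l) := (mul_sum _ _ _).symm
    _ ≤ exp (k * f) * ((k : ℝ) + 1) ^ 3 := by gcongr; exact sum_prod_colourRatio_le hk
    _ = _ := mul_comm _ _

lemma exp_mul_le_mass_add {P ρ : ℝ} {m : Fin 3 → ℝ} (h : IsMeanFieldSolution β P m) (hβ : 0 ≤ β)
    {S : Set (Config k)} (hS : ∀ σ ∉ S, ρ ≤ sqDist (colourRatio σ) m) :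
    exp (k * P) ≤ mass β S + exp (-(k * β * ρ)) * partitionFunction β k := by
  calc exp (k * P) = ∑ σ : Config k, exp (k * P) * ∏ l, m (σ l) := by
        rw [← mul_sum, ← Fintype.sum_pow, h.mem_stdSimplex.2, one_pow, mul_one]
    _ ≤ ∑ σ, (S.indicator (weight β) σ + exp (-(k * β * ρ)) * weight β σ) := by
        refine sum_le_sum fun σ _ => ?_
        have hprod : 0 ≤ exp (k * P) * ∏ l, m (σ l) :=
          mul_nonneg (exp_pos _).le (prod_nonneg fun l _ => h.mem_stdSimplex.1 _)
        by_cases hσ : σ ∈ S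
        · rw [Set.indicator_of_mem hσ]
          refine le_add_of_le_of_nonneg ?_ (mul_nonneg (exp_pos _).le (weight_pos β σ).le)
          rw [weight_eq_prod_mul_exp h]
          refine le_mul_of_one_le_right hprod (one_le_exp ?_)
          have := sqDist_nonneg (colourRatio σ) m
          positivity
        · rw [Set.indicator_of_notMem hσ, zero_add, weight_eq_prod_mul_exp h, mul_left_comm,
            ← exp_add]
          refine le_mul_of_one_le_right hprod (one_le_exp ?_)
          have : k * β * ρ ≤ k * β * sqDist (colourRatio σ) m := by gcongr; exact hS σ hσ
          linarith
    _ = _ := by rw [sum_add_distrib, ← mul_sum]; rfl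

lemma mass_extension {P : ℝ} {m : Fin 3 → ℝ} (h : IsMeanFieldSolution β P m)
    (S : Set (Config k)) :
    mass β (extension S) = exp P * ∑ σ, S.indicator 1 σ *
      (weight β σ * stepFactor β ((k : ℝ) + 1)⁻¹ m (colourRatio σ)) := by
  have hinit (σ : Config k) (c : Fin 3) : initialSpins k.le_succ (Fin.snoc σ c) = σ :=
    funext fun l => Fin.snoc_castSucc (α := fun _ => Fin 3) c σ l
  have hmem (σ : Config k) (c : Fin 3) : (Fin.snoc σ c : Config (k + 1)) ∈ extension S ↔ σ ∈ S := by
    rw [extension, Set.mem_preimage, hinit]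
  rw [mass, ← (Fin.snocEquiv fun _ => Fin 3).sum_comp, Fintype.sum_prod_type, sum_comm, mul_sum]
  refine sum_congr rfl fun σ _ => ?_
  by_cases hσ : σ ∈ S
  · rw [Set.indicator_of_mem hσ, Pi.one_apply, one_mul, ← sum_weight_snoc h]
    exact sum_congr rfl fun c _ => Set.indicator_of_mem ((hmem σ c).2 hσ) _
  · rw [Set.indicator_of_notMem hσ, zero_mul, mul_zero]
    exact sum_eq_zero fun c _ => Set.indicator_of_notMem (mt (hmem σ c).1 hσ) _

end Mass

/-! ## The exchange identity -/

section Exchange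

variable {k : ℕ} {β P δ : ℝ} {m : Fin 3 → ℝ} {S F : Set (Config k)}

lemma sum_sum_update {ι α : Type*} [Fintype ι] [DecidableEq ι] [Fintype α] (l : ι)
    (g : (ι → α) → α → ℝ) :
    ∑ σ, ∑ c, g σ c = ∑ σ, ∑ c, g (Function.update σ l c) (σ l) := by
  let exchange : (ι → α) × α → (ι → α) × α := fun p => (Function.update p.1 l p.2, p.1 l)
  have hinv : Function.Involutive exchange := fun p => by simp [exchange]
  rw [← Fintype.sum_prod_type', ← Fintype.sum_prod_type']
  exact (Equiv.sum_comp hinv.toPerm fun p : (ι → α) × α => g p.1 p.2).symm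

lemma mass_eq_sum_exchangeTerm (h : IsMeanFieldSolution β P m) (S : Set (Config k)) (l : Fin k) :
    mass β S = ∑ σ, weight β σ * ∑ c, S.indicator 1 (Function.update σ l c) *
      exchangeTerm β (k : ℝ)⁻¹ m (colourRatio σ) (σ l) c := by
  calc mass β S = ∑ σ, ∑ c, S.indicator (weight β) σ * m c := by
        simp only [← mul_sum, h.mem_stdSimplex.2, mul_one, mass]
    _ = ∑ σ, ∑ c, S.indicator (weight β) (Function.update σ l c) * m (σ l) := sum_sum_update l _
    _ = _ := by
        refine sum_congr rfl fun σ _ => ?_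
        rw [mul_sum]
        refine sum_congr rfl fun c _ => ?_
        rw [mul_left_comm, ← weight_update_mul h]
        by_cases hσ : Function.update σ l c ∈ S <;> simp [hσ]

/-- Only the configurations that a single exchange can carry across the boundary of `S`
contribute. -/
lemma natCast_mul_mass_sub (h : IsMeanFieldSolution β P m) (S : Set (Config k)) :
    k * (mass β S - ∑ σ, S.indicator 1 σ *
        (weight β σ * exchangeFactor β (k : ℝ)⁻¹ m (colourRatio σ))) =
      ∑ σ, weight β σ * ∑ l, ∑ c,
        (S.indicator 1 (Function.update σ l c) - S.indicator 1 σ) *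
          exchangeTerm β (k : ℝ)⁻¹ m (colourRatio σ) (σ l) c := by
  have hmass : k * mass β S = ∑ σ, weight β σ * ∑ l, ∑ c,
      S.indicator 1 (Function.update σ l c) *
        exchangeTerm β (k : ℝ)⁻¹ m (colourRatio σ) (σ l) c := by
    calc k * mass β S = ∑ _l : Fin k, mass β S := by simp
      _ = _ := by
        rw [sum_congr rfl fun l _ => mass_eq_sum_exchangeTerm h S l, sum_comm]
        simp only [mul_sum]
  rw [mul_sub, hmass, mul_sum, ← sum_sub_distrib]
  refine sum_congr rfl fun σ _ => ?_
  simp only [sub_mul, sum_sub_distrib, ← mul_sum, sum_exchangeTerm]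
  ring

lemma abs_mass_sub_le (hk : 0 < k) (hβ : 0 ≤ β) (h : IsMeanFieldSolution β P m)
    (hstable : ∀ σ ∉ F, ∀ l c, Function.update σ l c ∈ S ↔ σ ∈ S) :
    |mass β S - ∑ σ, S.indicator 1 σ *
      (weight β σ * exchangeFactor β (k : ℝ)⁻¹ m (colourRatio σ))| ≤ exp (8 * β) * mass β F := by
  have hk' : (0 : ℝ) < k := Nat.cast_pos.2 hk
  refine le_of_mul_le_mul_left ?_ hk'
  rw [← abs_of_pos hk', ← abs_mul, abs_of_pos hk', natCast_mul_mass_sub h, mass, mul_sum, mul_sum]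
  refine (abs_sum_le_sum_abs _ _).trans (sum_le_sum fun σ _ => ?_)
  by_cases hσ : σ ∈ F
  · have hterm (d c : Fin 3) := exchangeTerm_nonneg h.mem_stdSimplex β (k : ℝ)⁻¹ (colourRatio σ) d c
    have hjump (τ : Config k) : |S.indicator (1 : Config k → ℝ) τ - S.indicator 1 σ| ≤ 1 := by
      by_cases hτ : τ ∈ S <;> by_cases hσS : σ ∈ S <;> simp [hτ, hσS]
    have hbound := (exchangeFactor_mem_Icc hβ h.mem_stdSimplex (colourRatio_mem_stdSimplex hk σ)
      ⟨inv_nonneg.2 hk'.le, inv_le_one_of_one_le₀ (Nat.one_le_cast.2 hk)⟩).2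
    rw [Set.indicator_of_mem hσ, abs_mul, abs_of_pos (weight_pos β σ)]
    calc _ ≤ weight β σ * ∑ l, ∑ c, exchangeTerm β (k : ℝ)⁻¹ m (colourRatio σ) (σ l) c := by
          refine mul_le_mul_of_nonneg_left ?_ (weight_pos β σ).le
          refine (abs_sum_le_sum_abs _ _).trans (sum_le_sum fun l _ => ?_)
          refine (abs_sum_le_sum_abs _ _).trans (sum_le_sum fun c _ => ?_)
          rw [abs_mul, abs_of_nonneg (hterm _ _)]
          exact mul_le_of_le_one_left (hterm _ _) (hjump _)
      _ = k * (exchangeFactor β (k : ℝ)⁻¹ m (colourRatio σ) * weight β σ) := by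
          rw [sum_exchangeTerm]; ring
      _ ≤ k * (exp (8 * β) * weight β σ) := by have := weight_pos β σ; gcongr
  · have hconst (l c) :
        S.indicator (1 : Config k → ℝ) (Function.update σ l c) = S.indicator 1 σ := by
      by_cases hσS : σ ∈ S <;> simp [hstable σ hσ l c, hσS]
    simp [hconst, hσ]

lemma inv_sub_inv_succ_mem_Icc (hk : 0 < k) (hδ : δ ∈ Set.Icc 0 1) (hinv : (k : ℝ)⁻¹ ≤ δ ^ 2) :
    (k : ℝ)⁻¹ - ((k : ℝ) + 1)⁻¹ ∈ Set.Icc 0 (δ ^ 3) := by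
  have hk' : (0 : ℝ) < k := Nat.cast_pos.2 hk
  have hsucc : ((k : ℝ) + 1)⁻¹ ≤ (k : ℝ)⁻¹ := inv_anti₀ hk' (by linarith)
  refine ⟨sub_nonneg.2 hsucc, ?_⟩
  calc (k : ℝ)⁻¹ - ((k : ℝ) + 1)⁻¹ = (k : ℝ)⁻¹ * ((k : ℝ) + 1)⁻¹ := by field_simp; ring
    _ ≤ δ ^ 2 * δ ^ 2 := by gcongr; exact hsucc.trans hinv
    _ = δ ^ 4 := by ring
    _ ≤ δ ^ 3 := pow_le_pow_of_le_one hδ.1 hδ.2 (by norm_num)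

lemma exists_abs_sum_weight_mul_le (hβ : 0 ≤ β) :
    ∃ C, 0 ≤ C ∧ ∀ {m : Fin 3 → ℝ}, m ∈ stdSimplex ℝ (Fin 3) → ∀ {k : ℕ}, 0 < k → ∀ {δ : ℝ},
      δ ∈ Set.Icc 0 1 → (k : ℝ)⁻¹ ≤ δ ^ 2 → ∀ {S F : Set (Config k)},
        (∀ σ ∈ S, σ ∉ F → dist (colourRatio σ) m ≤ δ) →
          |∑ σ, S.indicator 1 σ * (weight β σ * (exchangeFactor β (k : ℝ)⁻¹ m (colourRatio σ) + 1 -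
            2 * stepFactor β ((k : ℝ) + 1)⁻¹ m (colourRatio σ)))| ≤
              C * δ ^ 3 * mass β S + 2 * exp (8 * β) * mass β F := by
  obtain ⟨C, hC, hlocal⟩ := exists_abs_exchangeFactor_add_one_sub_le (ι := Fin 3) hβ
  refine ⟨C, hC, fun {m} hm {k} hk {δ} hδ hinv {S F} hclose => ?_⟩
  have hk' : (0 : ℝ) < k := Nat.cast_pos.2 hk
  have hη : (k : ℝ)⁻¹ ∈ Set.Icc 0 1 :=
    ⟨inv_nonneg.2 hk'.le, inv_le_one_of_one_le₀ (Nat.one_le_cast.2 hk)⟩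
  have hε : ((k : ℝ) + 1)⁻¹ ∈ Set.Icc 0 (k : ℝ)⁻¹ := ⟨by positivity, by gcongr; linarith⟩
  have hdiff := inv_sub_inv_succ_mem_Icc hk hδ hinv
  rw [mass, mass, mul_sum, mul_sum, ← sum_add_distrib]
  refine (abs_sum_le_sum_abs _ _).trans (sum_le_sum fun σ _ => ?_)
  have hs := colourRatio_mem_stdSimplex hk σ
  have hW := weight_pos β σ
  have hindF : 0 ≤ F.indicator (weight β) σ :=
    Set.indicator_nonneg (fun σ _ => (weight_pos β σ).le) σ
  have hδ3 := pow_nonneg hδ.1 3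
  by_cases hσ : σ ∈ S
  swap
  · simp only [Set.indicator_of_notMem hσ, zero_mul, abs_zero, mul_zero, zero_add]
    positivity
  rw [Set.indicator_of_mem hσ, Set.indicator_of_mem hσ, Pi.one_apply, one_mul, abs_mul,
    abs_of_pos hW, mul_comm]
  by_cases hσF : σ ∈ F
  · have hcrude := abs_exchangeFactor_add_one_sub_le hβ hm hs hη ⟨hε.1, hε.2.trans hη.2⟩
    rw [Set.indicator_of_mem hσF]
    exact (mul_le_mul_of_nonneg_right hcrude hW.le).trans
      (le_add_of_nonneg_left (by positivity))
  · exact (mul_le_mul_of_nonneg_right (hlocal hm hs (hclose σ hσ hσF) hδ.2 ⟨hη.1, hinv⟩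
      ⟨hε.1, hε.2.trans hinv⟩ (by rw [abs_of_nonneg hdiff.1]; exact hdiff.2)) hW.le).trans
      (le_add_of_nonneg_right (by positivity))

lemma exists_abs_mass_extension_sub_le (hβ : 0 ≤ β) :
    ∃ C, 0 ≤ C ∧ ∀ {P : ℝ} {m : Fin 3 → ℝ}, IsMeanFieldSolution β P m → ∀ {k : ℕ}, 0 < k →
      ∀ {δ : ℝ}, δ ∈ Set.Icc 0 1 → (k : ℝ)⁻¹ ≤ δ ^ 2 → ∀ {S F : Set (Config k)},
        (∀ σ ∈ S, σ ∉ F → dist (colourRatio σ) m ≤ δ) →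
        (∀ σ ∉ F, ∀ l c, Function.update σ l c ∈ S ↔ σ ∈ S) →
          |mass β (extension S) - exp P * mass β S| ≤
            exp P * (C * (δ ^ 3 * mass β S + mass β F)) := by
  obtain ⟨C, hC, hlocal⟩ := exists_abs_sum_weight_mul_le hβ
  refine ⟨C + 3 * exp (8 * β), by positivity, ?_⟩
  intro P m h k hk δ hδ hinv S F hclose hstable
  have hsecond := hlocal h.mem_stdSimplex hk hδ hinv hclose
  have hexchange := abs_mass_sub_le hk hβ h hstable
  have hmass : mass β S = ∑ σ, S.indicator 1 σ * weight β σ :=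
    sum_congr rfl fun σ _ => by by_cases hσ : σ ∈ S <;> simp [hσ]
  simp only [mul_sub, mul_add, mul_one, sum_sub_distrib, sum_add_distrib, ← hmass,
    mul_left_comm _ (2 : ℝ), ← mul_sum] at hsecond
  rw [mass_extension h, ← mul_sub, abs_mul, abs_of_pos (exp_pos P)]
  gcongr
  have hS := mul_nonneg (pow_nonneg hδ.1 3) (mass_nonneg (β := β) S)
  have hF := mass_nonneg (β := β) F
  have he := (exp_pos (8 * β)).le
  rw [abs_le] at hsecond hexchange ⊢
  constructor <;> nlinarith [mul_nonneg hC hF, mul_nonneg hC hS, mul_nonneg he hS, mul_nonneg he hF]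

end Exchange

/-! ## Growth within a phase at criticality -/

section Growth

variable {k : ℕ} {δ : ℝ}

lemma criticalBeta_pos : 0 < criticalBeta := mul_pos two_pos (log_pos one_lt_two)

/-- The configurations in the given phase. -/
def phaseSet (k : ℕ) (r : Phase) : Set (Config k) := {σ | colourRatio σ ∈ basin r}

/-- The configurations whose profile is at distance more than `δ` from the centre of every
phase. -/
def farSet (k : ℕ) (δ : ℝ) : Set (Config k) := {σ | ∀ r, δ < dist (colourRatio σ) (center r)}

lemma existsUnique_mem_phaseSet (hk : 0 < k) (σ : Config k) : ∃! r, σ ∈ phaseSet k r := by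
  obtain ⟨r, hr⟩ := exists_mem_basin (colourRatio σ)
  exact ⟨r, hr, fun r' hr' => eq_of_mem_basin (colourRatio_mem_stdSimplex hk σ) hr' hr⟩

lemma exists_dist_le_of_notMem_farSet (hδ : δ ≤ 1 / 24) {σ : Config k} (hσ : σ ∉ farSet k δ) :
    ∃ r, σ ∈ phaseSet k r ∧ dist (colourRatio σ) (center r) ≤ δ := by
  simp only [farSet, Set.mem_ofPred_eq, not_forall, not_lt] at hσ
  obtain ⟨r, hr⟩ := hσ
  exact ⟨r, mem_basin_of_dist_lt (by linarith), hr⟩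

lemma dist_colourRatio_update_le (σ : Config k) (l : Fin k) (c : Fin 3) :
    dist (colourRatio (Function.update σ l c)) (colourRatio σ) ≤ (k : ℝ)⁻¹ := by
  have hk : 0 ≤ (k : ℝ)⁻¹ := by positivity
  refine (dist_pi_le_iff hk).2 fun i => ?_
  rw [colourRatio_update, Pi.add_apply, dist_self_add_left, Pi.smul_apply, smul_eq_mul, norm_mul,
    norm_of_nonneg hk]
  exact mul_le_of_le_one_right hk (abs_sub_le_one_of_mem_stdSimplex
    (single_mem_stdSimplex ℝ (σ l)) (single_mem_stdSimplex ℝ c) i)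

lemma update_mem_phaseSet_iff (hδ : δ ∈ Set.Icc 0 (1 / 24)) (hinv : (k : ℝ)⁻¹ ≤ δ ^ 2)
    {σ : Config k} (hσ : σ ∉ farSet k δ) (l : Fin k) (c : Fin 3) (r : Phase) :
    Function.update σ l c ∈ phaseSet k r ↔ σ ∈ phaseSet k r := by
  obtain ⟨r', hr', hdist⟩ := exists_dist_le_of_notMem_farSet hδ.2 hσ
  have hupdate : Function.update σ l c ∈ phaseSet k r' := by
    refine mem_basin_of_dist_lt ?_
    have := dist_triangle (colourRatio (Function.update σ l c)) (colourRatio σ) (center r')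
    have := dist_colourRatio_update_le σ l c
    nlinarith [hδ.1, hδ.2]
  have hunique := existsUnique_mem_phaseSet l.pos
  constructor <;> intro hr
  · rwa [(hunique _).unique hr hupdate]
  · rwa [(hunique _).unique hr hr']

lemma mass_farSet_le (hk : 0 < k) (hδ : 0 ≤ δ) : mass criticalBeta (farSet k δ) ≤
    ((k : ℝ) + 1) ^ 3 * exp (k * (criticalPressure - δ ^ 2 / 600)) := by
  refine mass_le_of_freeEnergy_le hk fun σ hσ => ?_
  obtain ⟨r, hr⟩ := exists_mem_basin (colourRatio σ)
  refine (freeEnergy_le_of_mem_basin (colourRatio_mem_stdSimplex hk σ) hr).trans ?_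
  gcongr
  exact (hσ r).le

lemma partitionFunction_criticalBeta_le (hk : 0 < k) :
    partitionFunction criticalBeta k ≤ ((k : ℝ) + 1) ^ 3 * exp (k * criticalPressure) := by
  rw [← mass_univ]
  refine mass_le_of_freeEnergy_le hk fun σ _ => ?_
  obtain ⟨r, hr⟩ := exists_mem_basin (colourRatio σ)
  refine (freeEnergy_le_of_mem_basin (colourRatio_mem_stdSimplex hk σ) hr).trans ?_
  linarith [sq_nonneg (dist (colourRatio σ) (center r))]

lemma exp_le_two_mul_mass_phaseSet (hk : 0 < k) (hδ : δ ∈ Set.Icc 0 (1 / 24))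
    (hdecay : ((k : ℝ) + 1) ^ 3 * exp (-(k * δ ^ 2 / 600)) ≤ 8 * δ ^ 3) (r : Phase) :
    exp (k * criticalPressure) ≤ 2 * mass criticalBeta (phaseSet k r) := by
  have hfar (σ : Config k) (hσ : σ ∉ phaseSet k r) :
      1 / 36 ≤ sqDist (colourRatio σ) (center r) := by
    have : 1 / 6 ≤ dist (colourRatio σ) (center r) :=
      not_lt.1 fun h => hσ (mem_basin_of_dist_lt h)
    nlinarith [sq_dist_le_sqDist (colourRatio σ) (center r)]
  have hsmall : ((k : ℝ) + 1) ^ 3 * exp (-(k * criticalBeta * (1 / 36))) ≤ 1 / 2 := by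
    have hrate : δ ^ 2 / 600 ≤ criticalBeta * (1 / 36) := by
      have := log_two_gt_d9
      rw [criticalBeta]
      nlinarith [hδ.1, hδ.2]
    calc _ ≤ ((k : ℝ) + 1) ^ 3 * exp (-(k * δ ^ 2 / 600)) := by
          rw [mul_assoc, mul_div_assoc]; gcongr
      _ ≤ 8 * δ ^ 3 := hdecay
      _ ≤ 8 * (1 / 24) ^ 3 := by have := hδ.1; gcongr; exact hδ.2
      _ ≤ 1 / 2 := by norm_num
  have hoff : exp (-(k * criticalBeta * (1 / 36))) * partitionFunction criticalBeta k ≤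
      1 / 2 * exp (k * criticalPressure) := by
    calc _ ≤ exp (-(k * criticalBeta * (1 / 36))) *
          (((k : ℝ) + 1) ^ 3 * exp (k * criticalPressure)) := by
          gcongr; exact partitionFunction_criticalBeta_le hk
      _ = ((k : ℝ) + 1) ^ 3 * exp (-(k * criticalBeta * (1 / 36))) *
          exp (k * criticalPressure) := by ring
      _ ≤ _ := by gcongr
  linarith [exp_mul_le_mass_add (isMeanFieldSolution_center r) criticalBeta_pos.le hfar]

lemma mass_farSet_le_mass_phaseSet (hk : 0 < k) (hδ : δ ∈ Set.Icc 0 (1 / 24))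
    (hdecay : ((k : ℝ) + 1) ^ 3 * exp (-(k * δ ^ 2 / 600)) ≤ 8 * δ ^ 3) (r : Phase) :
    mass criticalBeta (farSet k δ) ≤ 16 * δ ^ 3 * mass criticalBeta (phaseSet k r) := by
  have := pow_nonneg hδ.1 3
  calc _ ≤ ((k : ℝ) + 1) ^ 3 * exp (k * (criticalPressure - δ ^ 2 / 600)) :=
        mass_farSet_le hk hδ.1
    _ = ((k : ℝ) + 1) ^ 3 * exp (-(k * δ ^ 2 / 600)) * exp (k * criticalPressure) := by
        rw [mul_assoc, ← exp_add]; ring_nf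
    _ ≤ 8 * δ ^ 3 * (2 * mass criticalBeta (phaseSet k r)) := by
        gcongr; exact exp_le_two_mul_mass_phaseSet hk hδ hdecay r
    _ = _ := by ring

lemma exists_abs_mass_extension_phaseSet_sub_le : ∃ C, 0 ≤ C ∧ ∀ {k : ℕ}, 0 < k → ∀ {δ : ℝ},
    δ ∈ Set.Icc 0 (1 / 24) → (k : ℝ)⁻¹ ≤ δ ^ 2 →
    ((k : ℝ) + 1) ^ 3 * exp (-(k * δ ^ 2 / 600)) ≤ 8 * δ ^ 3 → ∀ r,
      |mass criticalBeta (extension (phaseSet k r)) -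
        exp criticalPressure * mass criticalBeta (phaseSet k r)| ≤
          exp criticalPressure * (C * δ ^ 3 * mass criticalBeta (phaseSet k r)) := by
  obtain ⟨C, hC, h⟩ := exists_abs_mass_extension_sub_le criticalBeta_pos.le
  refine ⟨17 * C, by positivity, fun {k} hk {δ} hδ hinv hdecay r => ?_⟩
  have hclose : ∀ σ ∈ phaseSet k r, σ ∉ farSet k δ → dist (colourRatio σ) (center r) ≤ δ := by
    intro σ hr hσ
    obtain ⟨r', hr', hdist⟩ := exists_dist_le_of_notMem_farSet hδ.2 hσ
    rwa [(existsUnique_mem_phaseSet hk σ).unique hr hr']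
  calc _ ≤ exp criticalPressure * (C * (δ ^ 3 * mass criticalBeta (phaseSet k r) +
        mass criticalBeta (farSet k δ))) :=
        h (isMeanFieldSolution_center r) hk ⟨hδ.1, by linarith [hδ.2]⟩ hinv hclose
          fun σ hσ l c => update_mem_phaseSet_iff hδ hinv hσ l c r
    _ ≤ exp criticalPressure * (C * (δ ^ 3 * mass criticalBeta (phaseSet k r) +
        16 * δ ^ 3 * mass criticalBeta (phaseSet k r))) := by
        gcongr; exact mass_farSet_le_mass_phaseSet hk hδ hdecay r
    _ = _ := by ring

/-- The factor by which the probability of an event about the first `k` spins grows when the model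
with `k` spins is replaced by the model with `k + 1` spins. -/
def growthRatio (S : Set (Config k)) : ℝ :=
  mass criticalBeta (extension S) / partitionFunction criticalBeta (k + 1) /
    (mass criticalBeta S / partitionFunction criticalBeta k)

lemma growthRatio_le {S : Set (Config k)} {a b : ℝ} (ha : 0 ≤ a) (hb : 0 < b)
    (hS : mass criticalBeta (extension S) ≤ a * mass criticalBeta S)
    (hZ : b * partitionFunction criticalBeta k ≤ partitionFunction criticalBeta (k + 1)) :
    growthRatio S ≤ a / b := by
  have hZk : 0 < partitionFunction criticalBeta k := partitionFunction_pos
  have hmass := mass_nonneg (β := criticalBeta) S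
  refine div_le_of_le_mul₀ (by positivity) (by positivity) ?_
  calc _ ≤ a * mass criticalBeta S / (b * partitionFunction criticalBeta k) := by gcongr
    _ = _ := by field_simp

lemma extension_univ : extension (Set.univ : Set (Config k)) = Set.univ := Set.preimage_univ

lemma mass_extension_mem_Icc (hk : 0 < k) (S : Set (Config k)) :
    mass criticalBeta (extension S) ∈
      Set.Icc (exp criticalPressure * (exp (-(8 * criticalBeta)) * mass criticalBeta S))
        (exp criticalPressure * (exp (8 * criticalBeta) * mass criticalBeta S)) := by
  have h := isMeanFieldSolution_center none
  have hstep (σ : Config k) := stepFactor_mem_Icc criticalBeta_pos.le h.mem_stdSimplex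
    (colourRatio_mem_stdSimplex hk σ) (ε := ((k : ℝ) + 1)⁻¹)
    ⟨by positivity, inv_le_one_of_one_le₀ (by linarith [Nat.cast_nonneg (α := ℝ) k])⟩
  rw [mass_extension h, mass]
  constructor <;> gcongr <;> rw [mul_sum] <;> refine sum_le_sum fun σ _ => ?_ <;>
    by_cases hσ : σ ∈ S <;> simp only [Set.indicator_of_mem, Set.indicator_of_notMem, hσ,
      not_false_eq_true, Pi.one_apply, one_mul, zero_mul, mul_zero, le_refl] <;>
    rw [mul_comm (weight criticalBeta σ)] <;>
    refine mul_le_mul_of_nonneg_right ?_ (weight_pos _ σ).le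
  exacts [(hstep σ).1, (hstep σ).2]

lemma growthRatio_le_exp (hk : 0 < k) (S : Set (Config k)) :
    growthRatio S ≤ exp (16 * criticalBeta) := by
  have hZ := (mass_extension_mem_Icc hk Set.univ).1
  rw [extension_univ, mass_univ, mass_univ, ← mul_assoc] at hZ
  have hS := (mass_extension_mem_Icc hk S).2
  rw [← mul_assoc] at hS
  refine (growthRatio_le (by positivity) (by positivity) hS hZ).trans_eq ?_
  rw [mul_div_mul_left _ _ (exp_pos _).ne', ← exp_sub]
  congr 1
  ring

lemma one_sub_mul_partitionFunction_le (hk : 0 < k) {ε : ℝ}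
    (h : ∀ r, |mass criticalBeta (extension (phaseSet k r)) -
      exp criticalPressure * mass criticalBeta (phaseSet k r)| ≤
        exp criticalPressure * (ε * mass criticalBeta (phaseSet k r))) :
    exp criticalPressure * (1 - ε) * partitionFunction criticalBeta k ≤
      partitionFunction criticalBeta (k + 1) := by
  rw [← sum_mass_eq_partitionFunction (existsUnique_mem_phaseSet hk),
    ← sum_mass_eq_partitionFunction (S := fun r => extension (phaseSet k r))
      fun σ => existsUnique_mem_phaseSet hk (initialSpins k.le_succ σ), mul_sum]
  exact sum_le_sum fun r _ => by linarith [neg_le_of_abs_le (h r)]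

lemma exists_growthRatio_phaseSet_le_of_le : ∃ C, 0 ≤ C ∧ ∀ {k : ℕ}, 0 < k → ∀ {δ : ℝ},
    0 ≤ δ → (k : ℝ)⁻¹ ≤ δ ^ 2 → ((k : ℝ) + 1) ^ 3 * exp (-(k * δ ^ 2 / 600)) ≤ 8 * δ ^ 3 →
      ∀ r, growthRatio (phaseSet k r) ≤ 1 + C * δ ^ 3 := by
  obtain ⟨C, hC, h⟩ := exists_abs_mass_extension_phaseSet_sub_le
  refine ⟨4 * C + exp (16 * criticalBeta) * (24 ^ 3 + 2 * C), by positivity, ?_⟩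
  intro k hk δ hδ hinv hdecay r
  have hδ3 := pow_nonneg hδ 3
  have hε : 0 ≤ C * δ ^ 3 := mul_nonneg hC hδ3
  have hexp := (exp_pos (16 * criticalBeta)).le
  rcases lt_or_ge 1 ((24 ^ 3 + 2 * C) * δ ^ 3) with hlarge | hsmall
  · nlinarith [growthRatio_le_exp hk (phaseSet k r)]
  have hδ' : δ ≤ 1 / 24 := le_of_pow_le_pow_left₀ three_ne_zero (by norm_num) (by linarith)
  have hmass := h hk ⟨hδ, hδ'⟩ hinv hdecay
  calc growthRatio (phaseSet k r)
      ≤ exp criticalPressure * (1 + C * δ ^ 3) / (exp criticalPressure * (1 - C * δ ^ 3)) :=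
        growthRatio_le (by positivity) (mul_pos (exp_pos _) (by linarith))
          (by linarith [le_of_abs_le (hmass r)]) (one_sub_mul_partitionFunction_le hk hmass)
    _ = (1 + C * δ ^ 3) / (1 - C * δ ^ 3) := mul_div_mul_left _ _ (exp_pos _).ne'
    _ ≤ 1 + 4 * (C * δ ^ 3) := by rw [div_le_iff₀ (by linarith)]; nlinarith
    _ ≤ _ := by
        have : 0 ≤ exp (16 * criticalBeta) * (24 ^ 3 + 2 * C) * δ ^ 3 := by positivity
        linarith

lemma log_rpow_div_rpow_three_halves (k : ℕ) :
    log k ^ (3 / 2 : ℝ) / (k : ℝ) ^ (3 / 2 : ℝ) = √(log k / k) ^ 3 := by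
  have hlog := log_natCast_nonneg k
  rw [← div_rpow hlog k.cast_nonneg, rpow_div_two_eq_sqrt _ (by positivity)]
  norm_cast

lemma exists_growthRatio_phaseSet_le : ∃ C, 0 ≤ C ∧ ∀ {k : ℕ}, 2 ≤ k → ∀ r,
    growthRatio (phaseSet k r) ≤ 1 + C * (log k ^ (3 / 2 : ℝ) / (k : ℝ) ^ (3 / 2 : ℝ)) := by
  obtain ⟨C, hC, h⟩ := exists_growthRatio_phaseSet_le_of_le
  refine ⟨C * 60 ^ 3, by positivity, fun {k} hk r => ?_⟩
  have hk2 : (2 : ℝ) ≤ k := by exact_mod_cast hk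
  have hkpos : (0 : ℝ) < k := by linarith
  have hlog : 1 / 2 ≤ log k := by linarith [log_le_log two_pos hk2, log_two_gt_d9]
  set δ := 60 * √(log k / k) with hδ
  have hδ_nonneg : 0 ≤ δ := by positivity
  have hδ_sq : δ ^ 2 = 3600 * log k / k := by
    rw [hδ, mul_pow, sq_sqrt (by positivity)]; ring
  have hinv : (k : ℝ)⁻¹ ≤ δ ^ 2 := by
    rw [hδ_sq, inv_eq_one_div]; gcongr; linarith
  have hinv' : (k : ℝ)⁻¹ ≤ δ := by
    refine le_of_sq_le_sq ?_ hδ_nonneg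
    exact (pow_le_of_le_one (by positivity) (inv_le_one_of_one_le₀ (by linarith))
      two_ne_zero).trans hinv
  have hexp : exp (-(k * δ ^ 2 / 600)) = (k : ℝ)⁻¹ ^ 6 := by
    rw [hδ_sq, mul_div_cancel₀ _ hkpos.ne', exp_neg, inv_pow, ← exp_log hkpos, ← exp_nat_mul,
      log_exp]
    congr 2
    push_cast
    ring
  have hdecay : ((k : ℝ) + 1) ^ 3 * exp (-(k * δ ^ 2 / 600)) ≤ 8 * δ ^ 3 := by
    calc _ ≤ (2 * (k : ℝ)) ^ 3 * (k : ℝ)⁻¹ ^ 6 := by rw [hexp]; gcongr; linarith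
      _ = 8 * (k : ℝ)⁻¹ ^ 3 := by field_simp; norm_num
      _ ≤ 8 * δ ^ 3 := by gcongr
  calc growthRatio (phaseSet k r) ≤ 1 + C * δ ^ 3 := h (by lia) hδ_nonneg hinv hdecay r
    _ = _ := by rw [log_rpow_div_rpow_three_halves, hδ]; ring

end Growth

/-! ## The interpolation to independence -/

section Interpolation

variable {k M : ℕ}

lemma sum_initialSpins (k n : ℕ) (f : Config k → ℝ) :
    ∑ x : Config (k + n), f (initialSpins (Nat.le_add_right k n) x) = 3 ^ n * ∑ σ, f σ := by
  rw [← (Fin.appendEquiv k n).sum_comp, Fintype.sum_prod_type, mul_sum]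
  refine sum_congr rfl fun σ _ => ?_
  have hinit (τ : Config n) :
      initialSpins (Nat.le_add_right k n) (Fin.appendEquiv k n (σ, τ)) = σ :=
    funext fun l => Fin.append_left σ τ l
  simp only [hinit, sum_const, card_univ, Fintype.card_fun, Fintype.card_fin, nsmul_eq_mul,
    Nat.cast_pow, Nat.cast_ofNat]

lemma interpProb_preimage_initialSpins (h : k ≤ M) (S : Set (Config k)) :
    interpProb h (initialSpins h ⁻¹' S) =
      mass criticalBeta S / partitionFunction criticalBeta k := by
  classical
  obtain ⟨n, rfl⟩ := Nat.exists_eq_add_of_le h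
  calc interpProb h (initialSpins h ⁻¹' S)
      = ∑ x, S.indicator (potts criticalBeta) (initialSpins h x) * (1 / 3) ^ n := by
        rw [interpProb, sum_filter]
        refine sum_congr rfl fun x _ => ?_
        rw [Set.indicator_apply, ite_mul, zero_mul, interpMass, Nat.add_sub_cancel_left]
        rfl
    _ = ∑ σ, S.indicator (potts criticalBeta) σ := by
        rw [← sum_mul, sum_initialSpins, mul_right_comm, ← mul_pow]
        norm_num
    _ = _ := by
        rw [mass, sum_div]
        refine sum_congr rfl fun σ _ => ?_
        rw [Set.indicator_apply, Set.indicator_apply, potts, ite_div, zero_div]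

lemma interpProb_univ (h : k ≤ M) : interpProb h Set.univ = 1 := by
  rw [← Set.preimage_univ (f := initialSpins h), interpProb_preimage_initialSpins, mass_univ,
    div_self partitionFunction_pos.ne']

lemma interpProb_succ_div_interpProb (h : k + 1 ≤ M) (S : Set (Config k)) :
    interpProb h (initialSpins (Nat.le_of_succ_le h) ⁻¹' S) /
      interpProb (Nat.le_of_succ_le h) (initialSpins (Nat.le_of_succ_le h) ⁻¹' S) =
        growthRatio S := by
  rw [interpProb_preimage_initialSpins, growthRatio, ← interpProb_preimage_initialSpins h]
  rfl

variable {J : ℕ}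

instance : Nonempty (Fin (numModes J k)) := by
  unfold numModes; split_ifs <;> infer_instance

lemma growthConst_of_le (hJ : k ≤ J) (h : k + 1 ≤ M) : growthConst J h = 1 := by
  simp only [growthConst, mode, if_pos hJ, interpProb_univ, div_one, ciSup_const]

lemma exists_mode_eq (hJ : J < k) (h : k ≤ M) (i : Fin (numModes J k)) :
    ∃ r, mode J h i = initialSpins h ⁻¹' phaseSet k r := by
  rw [mode, if_neg hJ.not_ge]
  split_ifs with hi
  · exact ⟨some ⟨i, hi⟩, rfl⟩
  · refine ⟨none, ?_⟩
    ext x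
    simp [majoritySet, phaseSet, basin]

lemma growthConst_le (hJ : J < k) (h : k + 1 ≤ M) {B : ℝ}
    (hB : ∀ r, growthRatio (phaseSet k r) ≤ B) : growthConst J h ≤ B := by
  refine ciSup_le fun i => ?_
  obtain ⟨r, hr⟩ := exists_mode_eq hJ (Nat.le_of_succ_le h) i
  rw [hr, interpProb_succ_div_interpProb]
  exact hB r

end Interpolation

end MeanFieldPotts

end

theorem mainTheorem6 :
    ∃ C : ℝ, 0 < C ∧ ∀ J : ℕ, 1 ≤ J → ∀ M : ℕ,
      (∀ h : 0 + 1 ≤ M, MeanFieldPotts.growthConst J (k := 0) (M := M) h = 1) ∧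
      (∀ h : 1 + 1 ≤ M, MeanFieldPotts.growthConst J (k := 1) (M := M) h = 1) ∧
      (∀ (j : ℕ) (h : j + 1 ≤ M), 2 ≤ j →
        MeanFieldPotts.growthConst J (k := j) (M := M) h ≤
          1 + C * (Real.log (j : ℝ) ^ (3 / 2 : ℝ) / (j : ℝ) ^ (3 / 2 : ℝ))) := by
  obtain ⟨C, hC, hgrowth⟩ := MeanFieldPotts.exists_growthRatio_phaseSet_le
  refine ⟨C + 1, by linarith, fun J hJ M => ⟨MeanFieldPotts.growthConst_of_le J.zero_le,
    MeanFieldPotts.growthConst_of_le hJ, fun j h hj => ?_⟩⟩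
  have hrate : 0 ≤ Real.log (j : ℝ) ^ (3 / 2 : ℝ) / (j : ℝ) ^ (3 / 2 : ℝ) :=
    div_nonneg (Real.rpow_nonneg (Real.log_natCast_nonneg j) _)
      (Real.rpow_nonneg (Nat.cast_nonneg j) _)
  rcases le_or_gt j J with hjJ | hJj
  · rw [MeanFieldPotts.growthConst_of_le hjJ h]
    exact le_add_of_nonneg_right (mul_nonneg (by linarith) hrate)
  · refine MeanFieldPotts.growthConst_le hJj h fun r => (hgrowth hj r).trans ?_
    gcongr
    linarith
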